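/- Let $K$ be an algebraically closed field of characteristic $0$. Varieties over $K$ are integral separated schemes of finite type over $K$; subvarieties are closed and irreducible (in particular non-empty). \textbf{Distinguished categories.} Let $\mathfrak C$ be a category with a covariant functor $\mathcal F$ to the category of varieties over $K$. It is called \emph{distinguished} if the following hold (we often write $X$ and $\phi$ for $\mathcal F(X)$ and $\mathcal F(\phi)$): (A1) any two objects $X,Y$ have a categorical product $X\times Y$ in $\mathfrak C$ such that the projections induce an isomorphism $\mathcal F(X\times Y)\to\mathcal F(X)\times_K\mathcal F(Y)$; (A2) for all morphisms $\phi:X\to Z$ and $\psi:Y\to Z$ of $\mathfrak C$ there are an integer $n\ge 0$ and morphisms $\phi_i:X_i\to X\times Y$ of $\mathfrak C$ ($i=1,\dots,n$) with $\bigcup_{i=1}^n\phi_i(X_i)=(X\times_Z Y)_{\mathrm{red}}\subset X\times_K Y$; (A3) $\mathfrak C$ has a final object, and $\mathcal F$ maps it to $\operatorname{Spec}K$; (A4) for every morphism $\phi:X\to Y$ of $\mathfrak C$, the image $\phi(X)$ is closed in $Y$, and there are morphisms $\phi_1:W\to X$, $\phi_2:W\to Z$, $\phi_3:Z\to Y$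 of $\mathfrak C$ with $\phi\circ\phi_1=\phi_3\circ\phi_2$ such that $\phi_1$ is finite and surjective, $\phi_3$ has finite fibers, $\phi_2$ is surjective with irreducible fibers, and the local dimension $\dim_w\phi_2^{-1}(\phi_2(w))$ does not depend on $w\in W$. Fix a distinguished category. Its objects and morphisms are called distinguished varieties and distinguished morphisms. \textbf{Definitions.} Let $Z$ be a distinguished variety. A \emph{special} subvariety of $Z$ is the image of a distinguished morphism to $Z$. A subvariety $W$ of $Z$ is \emph{weakly special} if it is an irreducible component of $\phi(\psi^{-1}(y))$ for some distinguished morphisms $\psi:Y\to X'$, $\phi:Y\to Z$ and some $y\in X'(K)$. For a subvariety $W$ of $Z$, let $\langle W\rangle$ (respectively $\langle W\rangle_{\mathrm{ws}}$) be the smallest special (respectively weakly special) subvariety of $Z$ containing $W$, and put $$\delta(W)=\dim\langle W\rangle-\dim W,\qquad \delta_{\mathrm{ws}}(W)=\dim\langle W\rangle_{\mathrm{ws}}-\dim W.$$ Let $V$ be a subvariety of $Z$. A subvariety $W\subset V$ is \emph{optimal for $V$ in $Z$} if $\delta(U)>\delta(W)$ for every subvariety $U$ with $W\subsetneq U\subset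 V$; it is \emph{weakly optimal for $V$ in $Z$} if the same holds with $\delta_{\mathrm{ws}}$ in place of $\delta$. Let $X$ be a distinguished variety and $x\in X(K)$. The \emph{$\Sigma$-orbit} of $x$ is the collection $\Sigma=(\Sigma_Z)_Z$, where $\Sigma_Z$ is the set of all $\phi(y)$ with $\phi:Y\to Z$ a distinguished morphism and $y\in Y(K)$ such that there is a distinguished morphism $\psi:Y\to X$ with finite fibers and $\psi(y)=x$. A weakly special subvariety $W$ of $Z$ is \emph{$\Sigma$-special} if there are distinguished morphisms $\psi:Y\to Z$, $\phi:Y\to X'$ and a point $x'\in\Sigma_{X'}$ such that $W$ is an irreducible component of $\psi(\phi^{-1}(x'))$. A subvariety $W$ of $V$ is a \emph{$\Sigma$-subvariety of $V$ in $Z$} if $\langle W\rangle_{\mathrm{ws}}$ is $\Sigma$-special; it is \emph{$\Sigma$-atypical for $V$ in $Z$} if moreover $\delta_{\mathrm{ws}}(W)<\dim Z-\dim V$. \emph{Maximal $\Sigma$-atypical} means maximal with respect to inclusion among the $\Sigma$-atypical subvarieties for $V$ in $Z$. \textbf{Proposition.} Let $X$ and $Z$ be distinguished varieties, let $\Sigma$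 be the $\Sigma$-orbit of $x\in X(K)$, and let $V$ be a subvariety of $Z$. (1) A subvariety $W$ of $V$ is a $\Sigma$-subvariety of $V$ in $Z$ if and only if $$\delta(W\times\{x\})-\delta_{\mathrm{ws}}(W)=\delta(\{x\}),$$ where the defects of $W\times\{x\}$, $W$ and $\{x\}$ are taken in $Z\times X$, $Z$ and $X$ respectively. (2) If a subvariety $W$ of $V$ is maximal $\Sigma$-atypical, then $W\times\{x\}$ is optimal for $V\times\{x\}$ in $Z\times X$. (3) Every maximal $\Sigma$-atypical subvariety of $V$ is weakly optimal for $V$ in $Z$. -/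

import Mathlib

open CategoryTheory CategoryTheory.Limits AlgebraicGeometry

namespace Distinguished

universe u v w

/-! ### Varieties over `K` -/

section Varieties

variable (K : Type u) [Field K]

/-- A variety over `K`: an integral separated scheme of finite type over `K`. -/
def isVariety : ObjectProperty (Over (Spec (CommRingCat.of K))) := fun X =>
  IsIntegral X.left ∧ IsSeparated X.hom ∧ LocallyOfFiniteType X.hom ∧ QuasiCompact X.hom

/-- The category of varieties over `K`, with morphisms of `K`-schemes. -/
abbrev Variety : Type (u + 1) := (isVariety K).FullSubcategory

end Varieties

/-! ### Subvarieties and dimensions -/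

section Topology

variable {T : Type u} [TopologicalSpace T]

/-- The (closed, irreducible) subvarieties of a variety, as sets of scheme points. -/
def IsSubvariety (W : Set T) : Prop := IsIrreducible W ∧ IsClosed W

/-- `W` is an irreducible component of the set `S`. -/
def IsComponentOf (W S : Set T) : Prop := Maximal (fun A : Set T => IsIrreducible A ∧ A ⊆ S) W

/-- The dimension of a subset. It is finite and at least `0` for a subvariety of a variety,
so that the values `0` for the empty set and for sets of infinite dimension never matter. -/
noncomputable def dim (W : Set T) : ℤ :=
  (((topologicalKrullDim W).unbotD 0).toNat : ℤ)

/-- The local dimension `dim_t S` of `S` at `t`: the least dimension of an open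
neighbourhood of `t` in `S`. -/
noncomputable def localDim (S : Set T) (t : T) : WithBot ℕ∞ :=
  ⨅ U : {U : Set T // IsOpen U ∧ t ∈ U}, topologicalKrullDim (S ∩ U.1 : Set T)

end Topology

/-! ### Distinguished categories -/

section Categories

variable {K : Type u} [Field K] {C : Type v} [Category.{w} C] (F : C ⥤ Variety K)

/-- The scheme underlying `F(X)`. -/
noncomputable abbrev sch (X : C) : Scheme.{u} := (F.obj X).obj.left

/-- The structure morphism of `F(X)`. -/
noncomputable abbrev str (X : C) : sch F X ⟶ Spec (CommRingCat.of K) := (F.obj X).obj.hom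

/-- The morphism of schemes underlying `F(φ)`. -/
noncomputable abbrev mor {X Y : C} (φ : X ⟶ Y) : sch F X ⟶ sch F Y := (F.map φ).hom.left

theorem mor_str {X Y : C} (φ : X ⟶ Y) : mor F φ ≫ str F Y = str F X :=
  Over.w (F.map φ).hom

/-- `F(φ)` has finite fibers. -/
def HasFiniteFibers {X Y : C} (φ : X ⟶ Y) : Prop :=
  ∀ y : sch F Y, ((mor F φ) ⁻¹' {y}).Finite

/-- `P` with the projections `p`, `q` is a product `X × Y`: it is a categorical product, and
`F(P)` with `F(p)`, `F(q)` is the product of `F(X)` and `F(Y)` over `K`. -/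
structure IsProduct {X Y P : C} (p : P ⟶ X) (q : P ⟶ Y) : Prop where
  isLimit : Nonempty (IsLimit (BinaryFan.mk p q))
  isPullback : IsPullback (mor F p) (mor F q) (str F X) (str F Y)

variable {F}

theorem fiberProduct_condition {X Y Z : C} (φ : X ⟶ Z) (ψ : Y ⟶ Z) :
    pullback.fst (mor F φ) (mor F ψ) ≫ str F X =
      pullback.snd (mor F φ) (mor F ψ) ≫ str F Y := by
  rw [← mor_str F φ, ← mor_str F ψ, ← Category.assoc, ← Category.assoc, pullback.condition]

/-- The underlying set of the fibered product of `φ : X ⟶ Z` and `ψ : Y ⟶ Z`, inside a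
product `P` of `X` and `Y`: the image of the canonical morphism
`F(X) ×_{F(Z)} F(Y) ⟶ F(X) ×_K F(Y) = F(P)`. -/
def fiberProductSet {X Y P Z : C} {p : P ⟶ X} {q : P ⟶ Y} (hP : IsProduct F p q)
    (φ : X ⟶ Z) (ψ : Y ⟶ Z) : Set (sch F P) :=
  Set.range (hP.isPullback.lift (pullback.fst (mor F φ) (mor F ψ))
    (pullback.snd (mor F φ) (mor F ψ)) (fiberProduct_condition φ ψ))

variable (F)

/-- A category `C` with a functor `F` to varieties over `K` is a distinguished category. -/
structure IsDistinguished : Prop where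
  /-- Direct products. -/
  directProducts : ∀ X Y : C, ∃ (P : C) (p : P ⟶ X) (q : P ⟶ Y), IsProduct F p q
  /-- Fibered products. -/
  fiberedProducts : ∀ {X Y P Z : C} {p : P ⟶ X} {q : P ⟶ Y} (hP : IsProduct F p q)
    (φ : X ⟶ Z) (ψ : Y ⟶ Z), ∃ (n : ℕ) (A : Fin n → C) (χ : ∀ i, A i ⟶ P),
      ⋃ i, Set.range (mor F (χ i)) = fiberProductSet hP φ ψ
  /-- Final object. -/
  finalObject : ∃ T : C, Nonempty (IsTerminal T) ∧ IsIso (str F T)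
  /-- Fiber dimension. -/
  fiberDimension : ∀ {X Y : C} (φ : X ⟶ Y), IsClosed (Set.range (mor F φ)) ∧
    ∃ (W Z : C) (φ₁ : W ⟶ X) (φ₂ : W ⟶ Z) (φ₃ : Z ⟶ Y),
      φ₁ ≫ φ = φ₂ ≫ φ₃ ∧
      IsFinite (mor F φ₁) ∧ Function.Surjective (mor F φ₁) ∧
      HasFiniteFibers F φ₃ ∧
      Function.Surjective (mor F φ₂) ∧
      (∀ z : sch F Z, z ∈ Set.range (mor F φ₂) → IsIrreducible ((mor F φ₂) ⁻¹' {z})) ∧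
      ∃ d : WithBot ℕ∞, ∀ t : sch F W,
        localDim ((mor F φ₂) ⁻¹' {(mor F φ₂) t}) t = d

/-! ### Special and weakly special subvarieties, defects, optimality -/

/-- The special subvarieties of `Z`: the images of distinguished morphisms. -/
def IsSpecial {Z : C} (W : Set (sch F Z)) : Prop :=
  ∃ (Y : C) (φ : Y ⟶ Z), W = Set.range (mor F φ)

/-- The weakly special subvarieties of `Z`. The points of `X(K)` are the closed points. -/
def IsWeaklySpecial {Z : C} (W : Set (sch F Z)) : Prop :=
  IsSubvariety W ∧ ∃ (Y X : C) (ψ : Y ⟶ X) (φ : Y ⟶ Z) (x : sch F X),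
    IsClosed {x} ∧ IsComponentOf W (mor F φ '' (mor F ψ ⁻¹' {x}))

/-- The special closure `⟨V⟩`, the smallest special subvariety containing `V`, written as
the intersection of all of them. -/
def specialClosure {Z : C} (V : Set (sch F Z)) : Set (sch F Z) :=
  ⋂₀ {S | IsSpecial F S ∧ V ⊆ S}

/-- The weakly special closure `⟨V⟩_ws`, the smallest weakly special subvariety containing
`V`, written as the intersection of all of them. -/
def weaklySpecialClosure {Z : C} (V : Set (sch F Z)) : Set (sch F Z) :=
  ⋂₀ {S | IsWeaklySpecial F S ∧ V ⊆ S}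

theorem specialClosure_eq_of_isLeast {Z : C} {V S : Set (sch F Z)}
    (h : IsLeast {S | IsSpecial F S ∧ V ⊆ S} S) : specialClosure F V = S :=
  Set.Subset.antisymm (Set.sInter_subset_of_mem h.1) (Set.subset_sInter fun _ hA => h.2 hA)

theorem weaklySpecialClosure_eq_of_isLeast {Z : C} {V S : Set (sch F Z)}
    (h : IsLeast {S | IsWeaklySpecial F S ∧ V ⊆ S} S) : weaklySpecialClosure F V = S :=
  Set.Subset.antisymm (Set.sInter_subset_of_mem h.1) (Set.subset_sInter fun _ hA => h.2 hA)

/-- The defect `δ(V)`. -/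
noncomputable def defect {Z : C} (V : Set (sch F Z)) : ℤ := dim (specialClosure F V) - dim V

/-- The weak defect `δ_ws(V)`. -/
noncomputable def weakDefect {Z : C} (V : Set (sch F Z)) : ℤ :=
  dim (weaklySpecialClosure F V) - dim V

/-- `W` is an optimal subvariety for `V`. -/
def IsOptimal {Z : C} (V W : Set (sch F Z)) : Prop :=
  IsSubvariety W ∧ W ⊆ V ∧ ∀ U, IsSubvariety U → W ⊂ U → U ⊆ V → defect F U > defect F W

/-- `W` is a weakly optimal subvariety for `V`. -/
def IsWeaklyOptimal {Z : C} (V W : Set (sch F Z)) : Prop :=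
  IsSubvariety W ∧ W ⊆ V ∧
    ∀ U, IsSubvariety U → W ⊂ U → U ⊆ V → weakDefect F U > weakDefect F W

/-! ### `Σ`-orbits and `Σ`-special subvarieties -/

/-- The `Σ`-orbit of `x ∈ X(K)`: the collection of the sets `Σ_Z(x)` for all `Z`. -/
def sigmaOrbit {X : C} (x : sch F X) (Z : C) : Set (sch F Z) :=
  {z | ∃ (Y : C) (φ : Y ⟶ Z) (ψ : Y ⟶ X) (y : sch F Y), IsClosed {y} ∧
    HasFiniteFibers F ψ ∧ mor F ψ y = x ∧ mor F φ y = z}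

variable {F} (S : ∀ Z : C, Set (sch F Z))

/-- A weakly special subvariety `W` of `Z` is `Σ`-special, for a collection `Σ` (written
`S`) of sets of closed points. -/
def IsSigmaSpecial {Z : C} (W : Set (sch F Z)) : Prop :=
  IsWeaklySpecial F W ∧ ∃ (Y X : C) (ψ : Y ⟶ Z) (φ : Y ⟶ X) (x : sch F X),
    x ∈ S X ∧ IsComponentOf W (mor F ψ '' (mor F φ ⁻¹' {x}))

/-- `W` is a `Σ`-subvariety of `V` in `Z`. -/
def IsSigmaSubvariety {Z : C} (V W : Set (sch F Z)) : Prop :=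
  IsSubvariety W ∧ W ⊆ V ∧ IsSigmaSpecial S (weaklySpecialClosure F W)

/-- `W` is a `Σ`-atypical subvariety for `V` in `Z`. -/
def IsSigmaAtypical {Z : C} (V W : Set (sch F Z)) : Prop :=
  IsSigmaSubvariety S V W ∧ weakDefect F W < dim (Set.univ : Set (sch F Z)) - dim V

/-- `W` is a maximal `Σ`-atypical subvariety for `V` in `Z`. -/
def IsMaximalSigmaAtypical {Z : C} (V W : Set (sch F Z)) : Prop :=
  Maximal (IsSigmaAtypical S V) W

variable (F)

/-- The subset `A × B` of the product `P` with projections `p` and `q`. -/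
def prodSet {X Y P : C} (p : P ⟶ X) (q : P ⟶ Y) (A : Set (sch F X)) (B : Set (sch F Y)) :
    Set (sch F P) :=
  mor F p ⁻¹' A ∩ mor F q ⁻¹' B

end Categories

end Distinguished

/-!
The dimension of a subvariety is the transcendence degree of the residue field of its generic
point (`topologicalKrullDim_closure_inter_fiber`, `dim_closure`). It is therefore additive along
morphisms (`pdim_eq_add`), does not change under morphisms with finite fibers, and does not
increase under any morphism.

The axiom on fibered products shows that special and weakly special subvarieties are closed under
intersection up to finite unions. Since varieties are Noetherian, the special and the weakly special
closure of an irreducible set are least elements, and images of special closures are special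
closures (`image_specialClosure`).

The axiom on fiber dimensions turns the special closure of `W × {y}` in `Z × Y` into a family over a
finite cover of `⟨y⟩` with irreducible fibers of constant dimension. The fiber over a point above
`y` gives a `Σ`-special subvariety `B` containing `W`, with `Σ` the orbit of `y`, and
`dim ⟨W × {y}⟩ = dim B + dim ⟨y⟩` (`exists_isSigmaSpecial`). Since `B` contains `⟨W⟩_ws`, the
left-hand side is at least `dim ⟨W⟩_ws + dim ⟨y⟩`, and equality means `B = ⟨W⟩_ws`. Conversely,
if `⟨W⟩_ws` is a component of a family of subvarieties at the image of `y` under a distinguished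
morphism, then the pullback of the family to `Y` forces equality (`dim_specialClosure_slice`).
Together these two facts are the numerical criterion of the first assertion
(`isSigmaSpecial_weaklySpecialClosure_iff`).

For the other two assertions, the point is that if `⟨W⟩_ws` is `Σ`-special and `W ⊆ U`, then
`⟨U⟩_ws` is `Σ`-special (`isSigmaSpecial_weaklySpecialClosure_of_subset`). This is a form of the
defect condition. The closure `⟨U⟩_ws` comes from the fiber over some point `t`, so that
`⟨U × {(x, t)}⟩` has the dimension of a product. Up to finite covers, the fibers of its projection
to `⟨U × {x}⟩` have constant dimension, so that those of `⟨W × {(x, t)}⟩` over `⟨W × {x}⟩` cannot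
be larger (`dim_specialClosure_sub_le`); comparing dimensions gives the claim for `U`.
Hence a subvariety of `V` strictly containing a maximal `Σ`-atypical `W` is again a
`Σ`-subvariety, and by maximality its weak defect exceeds that of `W`.
-/

namespace Distinguished

universe u v w

/-! ### Krull dimension and transcendence degree -/

section Algebra

theorem ringKrullDim_eq_of_isIntegral_of_injective {R S : Type*} [CommRing R] [CommRing S]
    [IsDomain S] [Algebra R S] [Algebra.IsIntegral R S]
    (h : Function.Injective (algebraMap R S)) : ringKrullDim S = ringKrullDim R := by
  apply le_antisymm
  · refine Order.krullDim_le_of_strictMono (PrimeSpectrum.comap (algebraMap R S)) fun a b hab => ?_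
    exact Ideal.IsIntegral.comap_lt_comap (R := R) (I := a.asIdeal) (J := b.asIdeal) hab
  · refine iSup_le fun l => ?_
    obtain ⟨Q, hQ, hQl⟩ := Ideal.exists_ideal_over_prime_of_isIntegral_of_isDomain (S := S)
      l.head.asIdeal (by rw [(RingHom.injective_iff_ker_eq_bot _).mp h]; exact bot_le)
    have : Q.LiesOver l.head.asIdeal := ⟨hQl.symm⟩
    obtain ⟨L, hL, -⟩ := Ideal.exists_ltSeries_of_hasGoingUp l Q
    rw [← hL]
    exact Order.LTSeries.length_le_krullDim L

/-- The dimension of an affine domain over a field is its transcendence degree, by Noether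
normalization. -/
theorem ringKrullDim_eq_trdeg (k B : Type*) [Field k] [CommRing B] [IsDomain B]
    [Algebra k B] [Algebra.FiniteType k B] :
    ringKrullDim B = ((Cardinal.toNat (Algebra.trdeg k B) : ℕ) : WithBot ℕ∞) := by
  obtain ⟨s, g, hg, hi⟩ := exists_integral_inj_algHom_of_fg k B
  let := g.toRingHom.toAlgebra
  have : Algebra.IsIntegral (MvPolynomial (Fin s) k) B := ⟨hi⟩
  have : IsScalarTower k (MvPolynomial (Fin s) k) B :=
    .of_algebraMap_eq fun x => (g.commutes x).symm
  have hinj : Function.Injective (algebraMap (MvPolynomial (Fin s) k) B) := hg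
  have : FaithfulSMul (MvPolynomial (Fin s) k) B :=
    (faithfulSMul_iff_algebraMap_injective _ _).mpr hinj
  rw [ringKrullDim_eq_of_isIntegral_of_injective hinj]
  have h := lift_trdeg_add_eq k (MvPolynomial (Fin s) k) B
  rw [trdeg_eq_zero (R := MvPolynomial (Fin s) k), MvPolynomial.trdeg_of_isDomain] at h
  have h' := congrArg Cardinal.toNat h
  simp at h'
  rw [← h', MvPolynomial.ringKrullDim_of_isNoetherianRing]
  simp

/-- The transcendence degree of a ring homomorphism, as a natural number. It has the value `0` if
the transcendence degree is infinite, so it is meaningful only together with `FinTrd`. -/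
noncomputable def trd {k l : Type*} [CommRing k] [CommRing l] (φ : k →+* l) : ℕ :=
  Cardinal.toNat (@Algebra.trdeg k l _ _ φ.toAlgebra)

/-- The ring homomorphism `φ` has finite transcendence degree. -/
def FinTrd {k l : Type*} [CommRing k] [CommRing l] (φ : k →+* l) : Prop :=
  @Algebra.trdeg k l _ _ φ.toAlgebra < Cardinal.aleph0

theorem trd_comp {k l m : Type*} [Field k] [Field l] [Field m] (φ : k →+* l) (ψ : l →+* m)
    (hφ : FinTrd φ) (hψ : FinTrd ψ) : trd (ψ.comp φ) = trd φ + trd ψ := by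
  let := φ.toAlgebra
  let := ψ.toAlgebra
  let := (ψ.comp φ).toAlgebra
  have : IsScalarTower k l m := .of_algebraMap_eq fun x => rfl
  have h := congrArg Cardinal.toNat (lift_trdeg_add_eq k l m)
  rw [Cardinal.toNat_add (Cardinal.lift_lt_aleph0.mpr hφ)
    (Cardinal.lift_lt_aleph0.mpr hψ), Cardinal.toNat_lift, Cardinal.toNat_lift,
    Cardinal.toNat_lift] at h
  exact h.symm

/-- If a field `κ` consists of fractions of elements of the image of a finitely generated
`k`-algebra `B`, then the dimension of this image is the transcendence degree of `κ` over `k`. -/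
theorem ringKrullDim_quotient_ker_eq_trd {k B κ : Type*} [Field k] [CommRing B] [Field κ]
    (ψ : k →+* B) (hψ : ψ.FiniteType) (φ : B →+* κ)
    (hφ : ∀ z : κ, ∃ x r : B, φ r ≠ 0 ∧ φ r * z = φ x) :
    FinTrd (φ.comp ψ) ∧
      ringKrullDim (B ⧸ RingHom.ker φ) = ((trd (φ.comp ψ) : ℕ) : WithBot ℕ∞) := by
  let := ψ.toAlgebra
  let := (φ.comp ψ).toAlgebra
  have : Algebra.FiniteType k B := hψ
  have hprime : (RingHom.ker φ).IsPrime := RingHom.ker_isPrime φ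
  let φ' := RingHom.kerLift φ
  have hinj : Function.Injective φ' := RingHom.kerLift_injective φ
  let := φ'.toAlgebra
  have : IsScalarTower k (B ⧸ RingHom.ker φ) κ := .of_algebraMap_eq fun x => rfl
  have : FaithfulSMul (B ⧸ RingHom.ker φ) κ := (faithfulSMul_iff_algebraMap_injective _ _).mpr hinj
  have hfrac : IsFractionRing (B ⧸ RingHom.ker φ) κ := by
    refine IsFractionRing.of_field _ _ fun z => ?_
    obtain ⟨x, r, hr, hz⟩ := hφ z
    refine ⟨Ideal.Quotient.mk _ x, Ideal.Quotient.mk _ r, ?_⟩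
    change z = φ x / φ r
    rw [← hz, mul_div_cancel_left₀ _ hr]
  have halg : Algebra.IsAlgebraic (B ⧸ RingHom.ker φ) κ := IsLocalization.isAlgebraic _
    (nonZeroDivisors (B ⧸ RingHom.ker φ))
  have hk : FaithfulSMul k (B ⧸ RingHom.ker φ) :=
    (faithfulSMul_iff_algebraMap_injective _ _).mpr (algebraMap k _).injective
  have h := lift_trdeg_add_eq k (B ⧸ RingHom.ker φ) κ
  rw [trdeg_eq_zero (R := B ⧸ RingHom.ker φ)] at h
  simp only [Cardinal.lift_zero, add_zero] at h
  have hfin : Algebra.trdeg k (B ⧸ RingHom.ker φ) < Cardinal.aleph0 :=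
    trdeg_lt_aleph0_of_finiteType
  have h1 : Algebra.trdeg k κ < Cardinal.aleph0 := by
    rw [← Cardinal.lift_lt_aleph0, ← h]; simpa using hfin
  refine ⟨h1, ?_⟩
  rw [ringKrullDim_eq_trdeg k]
  have h2 := congrArg Cardinal.toNat h
  simp only [Cardinal.toNat_lift] at h2
  rw [h2]
  rfl

end Algebra

/-! ### Dimension of topological spaces -/

section Topology

open TopologicalSpace

theorem topologicalKrullDim_mono {T : Type*} [TopologicalSpace T] {A B : Set T} (h : A ⊆ B) :
    topologicalKrullDim A ≤ topologicalKrullDim B :=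
  (Topology.IsEmbedding.inclusion h).isInducing.topologicalKrullDim_le

theorem topologicalKrullDim_image {T T' : Type*} [TopologicalSpace T] [TopologicalSpace T']
    {f : T → T'} (hf : Topology.IsEmbedding f) (A : Set T) :
    topologicalKrullDim (f '' A) = topologicalKrullDim A :=
  (IsHomeomorph.topologicalKrullDim_eq _ (hf.homeomorphImage A).isHomeomorph).symm

/-- A chain of irreducible closed subsets is met by every neighbourhood of a point of its least
member, so the dimension is bounded by the local dimensions. -/
theorem topologicalKrullDim_le_of_localDim_le {T : Type*} [TopologicalSpace T] {S : Set T}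
    {d : WithBot ℕ∞} (h : ∀ t ∈ S, localDim S t ≤ d) : topologicalKrullDim S ≤ d := by
  refine iSup_le fun l => ?_
  obtain ⟨t, ht⟩ := l.head.isIrreducible.nonempty
  refine le_trans (le_iInf fun U => ?_) (h t t.2)
  have hU : IsOpen ((↑) ⁻¹' U.1 : Set S) := U.2.1.preimage continuous_subtype_val
  have hmem : ∀ i, ((Subtype.val : ((↑) ⁻¹' U.1 : Set S) → S) ⁻¹' (l i : Set S)).Nonempty := by
    intro i
    exact ⟨⟨t, U.2.2⟩, (LTSeries.head_le l i : l.head ≤ l i) ht⟩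
  let e := TopologicalSpace.IrreducibleCloseds.orderIsoOfIsOpenEmbedding
    (Subtype.val : ((↑) ⁻¹' U.1 : Set S) → S) hU.isOpenEmbedding_subtypeVal
  let L : LTSeries (IrreducibleCloseds ((↑) ⁻¹' U.1 : Set S)) :=
    { length := l.length
      toFun := fun i => e.symm ⟨l i, hmem i⟩
      step := fun i => e.symm.strictMono (l.step i) }
  have h1 : (l.length : WithBot ℕ∞) ≤ topologicalKrullDim ((↑) ⁻¹' U.1 : Set S) :=
    Order.LTSeries.length_le_krullDim L
  refine h1.trans ?_
  let f : ((↑) ⁻¹' U.1 : Set S) → (S ∩ U.1 : Set T) := fun x => ⟨x.1.1, x.1.2, x.2⟩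
  have hf : Topology.IsInducing f := by
    have h2 : Topology.IsInducing (fun x : ((↑) ⁻¹' U.1 : Set S) => (x.1.1 : T)) :=
      (Topology.IsInducing.subtypeVal (t := S)).comp Topology.IsInducing.subtypeVal
    exact .of_comp (by fun_prop) continuous_subtype_val h2
  exact hf.topologicalKrullDim_le

theorem localDim_le {T : Type*} [TopologicalSpace T] {S U : Set T} {t : T} (hU : IsOpen U)
    (ht : t ∈ U) : localDim S t ≤ topologicalKrullDim (S ∩ U : Set T) :=
  iInf_le (fun U : {U : Set T // IsOpen U ∧ t ∈ U} => topologicalKrullDim (S ∩ U.1 : Set T))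
    ⟨U, hU, ht⟩

theorem topologicalKrullDim_eq_of_localDim_eq {T : Type*} [TopologicalSpace T] {S : Set T}
    {d : WithBot ℕ∞} (hS : S.Nonempty) (h : ∀ t ∈ S, localDim S t = d) :
    topologicalKrullDim S = d := by
  obtain ⟨t, ht⟩ := hS
  refine le_antisymm (topologicalKrullDim_le_of_localDim_le fun t ht => (h t ht).le) ?_
  rw [← h t ht]
  exact (localDim_le isOpen_univ (Set.mem_univ t)).trans
    (topologicalKrullDim_mono Set.inter_subset_left)

theorem topologicalKrullDim_eq_of_forall_exists_isOpen {T : Type*} [TopologicalSpace T]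
    {S : Set T} {d : WithBot ℕ∞} (hS : S.Nonempty)
    (h : ∀ t ∈ S, ∃ U, IsOpen U ∧ t ∈ U ∧ topologicalKrullDim (S ∩ U : Set T) = d) :
    topologicalKrullDim S = d := by
  obtain ⟨t, ht⟩ := hS
  refine le_antisymm (topologicalKrullDim_le_of_localDim_le fun t ht => ?_) ?_
  · obtain ⟨U, hU, htU, hd⟩ := h t ht
    exact hd ▸ localDim_le hU htU
  · obtain ⟨U, hU, htU, hd⟩ := h t ht
    exact hd ▸ topologicalKrullDim_mono Set.inter_subset_left

/-- A chain of irreducible closed subsets of `A` is lengthened by `B` itself. -/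
theorem topologicalKrullDim_add_one_le {T : Type*} [TopologicalSpace T] {A B : Set T}
    (hA : IsClosed A) (hB : IsIrreducible B) (hAB : A ⊂ B) :
    topologicalKrullDim A + 1 ≤ topologicalKrullDim B := by
  rcases A.eq_empty_or_nonempty with rfl | hne
  · have : topologicalKrullDim (∅ : Set T) = ⊥ := by
      rw [topologicalKrullDim, Order.krullDim_eq_bot_iff]
      exact ⟨fun x => x.isIrreducible.nonempty.some.2⟩
    simp [this]
  let top : IrreducibleCloseds B :=
    { carrier := Set.univ
      isIrreducible' := by
        have := Subtype.irreducibleSpace hB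
        exact IrreducibleSpace.isIrreducible_univ B
      isClosed' := isClosed_univ }
  let f : IrreducibleCloseds A → IrreducibleCloseds B :=
    IrreducibleCloseds.map (Set.inclusion hAB.1) (continuous_inclusion hAB.1)
  have hf : StrictMono f :=
    IrreducibleCloseds.map_strictMono_of_isInducing
      (Topology.IsEmbedding.inclusion hAB.1).isInducing
  have hlt : ∀ x, f x < top := by
    intro x
    refine lt_of_le_of_ne (fun _ _ => trivial) fun h => hAB.2 fun b hb => ?_
    have h1 : (⟨b, hb⟩ : B) ∈ closure (Set.inclusion hAB.1 '' (x : Set A)) := by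
      have : (⟨b, hb⟩ : B) ∈ f x := h ▸ trivial
      exact this
    have h2 : closure (Set.inclusion hAB.1 '' (x : Set A)) ⊆ Subtype.val ⁻¹' A := by
      refine closure_minimal ?_ (hA.preimage continuous_subtype_val)
      rintro _ ⟨a, -, rfl⟩
      exact a.2
    exact h2 h1
  have hne' : Nonempty (LTSeries (IrreducibleCloseds A)) := by
    obtain ⟨a, ha⟩ := hne
    exact ⟨RelSeries.singleton _
      ⟨closure {⟨a, ha⟩}, isIrreducible_singleton.closure, isClosed_closure⟩⟩
  by_cases htop : topologicalKrullDim A = ⊤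
  · have := topologicalKrullDim_mono hAB.1
    rw [htop, top_le_iff] at this
    simp [this]
  have hbot : topologicalKrullDim A ≠ ⊥ := fun h => by
    rw [topologicalKrullDim, Order.krullDim_eq_bot_iff] at h
    exact h.elim hne'.some.head
  have := Order.finiteDimensionalOrder_iff_krullDim_ne_bot_and_top.mpr ⟨hbot, htop⟩
  have h1 : topologicalKrullDim A = ((LTSeries.longestOf (IrreducibleCloseds A)).length : ℕ) :=
    Order.krullDim_eq_length_of_finiteDimensionalOrder
  rw [h1]
  let L : LTSeries (IrreducibleCloseds B) :=
    ((LTSeries.longestOf (IrreducibleCloseds A)).map f hf).snoc top (hlt _)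
  have h2 : (L.length : WithBot ℕ∞) ≤ topologicalKrullDim B := Order.LTSeries.length_le_krullDim L
  have h3 : L.length = (LTSeries.longestOf (IrreducibleCloseds A)).length + 1 := rfl
  rw [h3] at h2
  exact_mod_cast h2

end Topology

/-! ### Relative dimension of morphisms of schemes -/

section Schemes

/-- The dimension of the closure of a point of a scheme locally of finite type over a field is the
transcendence degree of its residue field; the latter enters as a preimmersion of the spectrum
of a field. -/
theorem topologicalKrullDim_closure_range {k κ : Type u} [Field k] [Field κ] {X : Scheme.{u}}
    (f : X ⟶ Spec (CommRingCat.of k)) [LocallyOfFiniteType f]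
    (i : Spec (CommRingCat.of κ) ⟶ X) [IsPreimmersion i]
    (α : CommRingCat.of k ⟶ CommRingCat.of κ) (hα : Spec.map α = i ≫ f) :
    FinTrd α.hom ∧
      topologicalKrullDim (closure (Set.range i)) = ((trd α.hom : ℕ) : WithBot ℕ∞) := by
  have hrange : (Set.range i).Nonempty := Set.range_nonempty _
  have key : ∀ t ∈ closure (Set.range i), ∃ U : Set X, IsOpen U ∧ t ∈ U ∧
      (FinTrd α.hom ∧ topologicalKrullDim (closure (Set.range i) ∩ U : Set X) =
        ((trd α.hom : ℕ) : WithBot ℕ∞)) := by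
    intro t ht
    obtain ⟨B, j, hj, htj⟩ : ∃ (B : CommRingCat.{u}) (j : Spec B ⟶ X),
        IsOpenImmersion j ∧ t ∈ Set.range j :=
      ⟨_, X.affineCover.f (X.affineCover.idx t), X.affineCover.map_prop _,
        X.affineCover.covers t⟩
    refine ⟨Set.range j, j.isOpenEmbedding.isOpen_range, htj, ?_⟩
    -- An open set that meets the closure of a point contains this point.
    have hsub : Set.range i ⊆ Set.range j := by
      obtain ⟨s, hs, s', rfl⟩ := mem_closure_iff.mp ht _ j.isOpenEmbedding.isOpen_range htj
      rintro _ ⟨a, rfl⟩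
      rwa [Subsingleton.elim (α := PrimeSpectrum κ) a s']
    let i' := IsOpenImmersion.lift j i hsub
    have hi' : i' ≫ j = i := IsOpenImmersion.lift_fac j i hsub
    have : IsPreimmersion (i' ≫ j) := by rw [hi']; infer_instance
    have hpre : IsPreimmersion i' := IsPreimmersion.of_comp i' j
    obtain ⟨φ, hφ⟩ := Spec.homEquiv.symm.surjective i'
    obtain ⟨ψ, hψ⟩ := Spec.homEquiv.symm.surjective (j ≫ f)
    change Spec.map φ = i' at hφ
    change Spec.map ψ = j ≫ f at hψ
    have hcomp : ψ ≫ φ = α := by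
      apply Spec.map_injective
      rw [Spec.map_comp, hφ, hψ, hα, ← Category.assoc, hi']
    have hft : ψ.hom.FiniteType := by
      have : LocallyOfFiniteType (Spec.map ψ) := by rw [hψ]; infer_instance
      exact HasRingHomProperty.Spec_iff.mp this
    rw [← hφ, IsPreimmersion.SpecMap_iff] at hpre
    have hstalk := RingHom.surjectiveOnStalks_iff_forall_ideal.mp hpre.2 ⊥ bot_ne_top
    obtain ⟨h1, h2⟩ := ringKrullDim_quotient_ker_eq_trd ψ.hom hft φ.hom fun z => by
      obtain ⟨x, r, c, hc, hr, h⟩ := hstalk z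
      refine ⟨x, r, hr, mul_left_cancel₀ (a := c) hc ?_⟩
      rw [← mul_assoc, h]
    have hαe : φ.hom.comp ψ.hom = α.hom := by rw [← hcomp]; rfl
    rw [hαe] at h1 h2
    refine ⟨h1, ?_⟩
    rw [← h2, ← PrimeSpectrum.topologicalKrullDim_eq_ringKrullDim]
    have himg : closure (Set.range i) ∩ Set.range j =
        j '' (closure (Set.range i')) := by
      have : Set.range i = j '' Set.range i' := by
        rw [← Set.range_comp, ← hi']
        rfl
      rw [this, ← Set.image_preimage_eq_inter_range]
      rw [j.isOpenEmbedding.isEmbedding.closure_eq_preimage_closure_image]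
    rw [himg, topologicalKrullDim_image j.isOpenEmbedding.isEmbedding]
    have hcl : closure (Set.range i') =
        Set.range (PrimeSpectrum.comap (Ideal.Quotient.mk (RingHom.ker φ.hom))) := by
      rw [range_comap_of_surjective _ _ Ideal.Quotient.mk_surjective,
        Ideal.mk_ker, ← hφ]
      exact PrimeSpectrum.closure_range_comap φ.hom
    rw [hcl, ← Set.image_univ]
    have := (PrimeSpectrum.isClosedEmbedding_comap_of_surjective _
      (Ideal.Quotient.mk (RingHom.ker φ.hom)) Ideal.Quotient.mk_surjective).isEmbedding
    refine (topologicalKrullDim_image this _).trans ?_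
    exact IsHomeomorph.topologicalKrullDim_eq _ (Homeomorph.Set.univ _).isHomeomorph
  refine ⟨?_, topologicalKrullDim_eq_of_forall_exists_isOpen hrange.closure fun t ht => ?_⟩
  · obtain ⟨t, ht⟩ := hrange.closure
    obtain ⟨-, -, -, h, -⟩ := key t ht
    exact h
  · obtain ⟨U, h1, h2, -, h3⟩ := key t ht
    exact ⟨U, h1, h2, h3⟩

/-- The relative dimension of a morphism of schemes at a point: the transcendence degree of the
extension of residue fields, which is finite if the morphism is locally of finite type. -/
noncomputable def relDim {X Y : Scheme.{u}} (f : X ⟶ Y) (t : X) : ℕ :=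
  trd (f.residueFieldMap t).hom

/-- The closure of `t` in its fiber has dimension the transcendence degree of the residue field of
`t` over that of its image: the scheme-theoretic fiber is of finite type over the latter. -/
theorem finTrd_and_topologicalKrullDim_fiber {X Y : Scheme.{u}} (f : X ⟶ Y)
    [LocallyOfFiniteType f] (t : X) : FinTrd (f.residueFieldMap t).hom ∧
      topologicalKrullDim (closure {t} ∩ f ⁻¹' {f t} : Set X) =
        ((relDim f t : ℕ) : WithBot ℕ∞) := by
  have : LocallyOfFiniteType (f.fiberToSpecResidueField (f t)) :=
    inferInstanceAs (LocallyOfFiniteType (pullback.snd _ _))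
  obtain ⟨h1, h2⟩ := topologicalKrullDim_closure_range (k := Y.residueField (f t))
    (κ := X.residueField t) (f.fiberToSpecResidueField (f t)) (f.asFiberHom t)
    (f.residueFieldMap t) (by simp)
  refine ⟨h1, ?_⟩
  have hset : closure {t} ∩ f ⁻¹' {f t} = f.fiberι (f t) '' closure {f.asFiber t} := by
    rw [(f.fiberι (f t)).isEmbedding.closure_eq_preimage_closure_image,
      Set.image_preimage_eq_inter_range, f.range_fiberι, Set.image_singleton, f.fiberι_asFiber]
  rw [relDim, ← h2, f.range_asFiberHom, hset,
    topologicalKrullDim_image (f.fiberι (f t)).isEmbedding]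

theorem finTrd_residueFieldMap {X Y : Scheme.{u}} (f : X ⟶ Y) [LocallyOfFiniteType f] (t : X) :
    FinTrd (f.residueFieldMap t).hom :=
  (finTrd_and_topologicalKrullDim_fiber f t).1

theorem topologicalKrullDim_closure_inter_fiber {X Y : Scheme.{u}} (f : X ⟶ Y)
    [LocallyOfFiniteType f] (t : X) :
      topologicalKrullDim (closure {t} ∩ f ⁻¹' {f t} : Set X) =
        ((relDim f t : ℕ) : WithBot ℕ∞) :=
  (finTrd_and_topologicalKrullDim_fiber f t).2

theorem relDim_comp {X Y Z : Scheme.{u}} (f : X ⟶ Y) (g : Y ⟶ Z) [LocallyOfFiniteType f]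
    [LocallyOfFiniteType g] (t : X) : relDim (f ≫ g) t = relDim f t + relDim g (f t) := by
  have h : ((f ≫ g).residueFieldMap t).hom =
      (f.residueFieldMap t).hom.comp (g.residueFieldMap (f t)).hom := by
    rw [Scheme.residueFieldMap_comp]
    rfl
  rw [relDim, relDim, relDim, add_comm, ← trd_comp _ _ (finTrd_residueFieldMap g (f t))
    (finTrd_residueFieldMap f t)]
  exact congrArg trd h

theorem relDim_eq_zero_of_finite {X Y : Scheme.{u}} (f : X ⟶ Y) [LocallyOfFiniteType f] (t : X)
    (h : (f ⁻¹' {f t}).Finite) : relDim f t = 0 := by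
  have : Finite (f ⁻¹' {f t}) := h
  have : Finite (f.fiber (f t)) := Finite.of_equiv _ (f.fiberHomeo (f t)).symm.toEquiv
  have : DiscreteTopology (f ⁻¹' {f t}) :=
    (f.fiberHomeo (f t)).symm.isEmbedding.discreteTopology
  have h1 := topologicalKrullDim_zero_of_discreteTopology (f ⁻¹' {f t})
  have h2 := topologicalKrullDim_closure_inter_fiber f t ▸
    topologicalKrullDim_mono (Set.inter_subset_right (s := closure {t}) (t := f ⁻¹' {f t}))
  have h3 : ((relDim f t : ℕ) : WithBot ℕ∞) ≤ 0 := h2.trans h1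
  exact Nat.le_zero.mp (by exact_mod_cast h3)

end Schemes

/-! ### Varieties as schemes -/

section Varieties

variable {K : Type u} [Field K] {C : Type v} [Category.{w} C] (F : C ⥤ Variety K)

instance (X : C) : IsIntegral (sch F X) := (F.obj X).property.1

instance (X : C) : LocallyOfFiniteType (str F X) := (F.obj X).property.2.2.1

instance (X : C) : QuasiCompact (str F X) := (F.obj X).property.2.2.2

instance (X : C) : IsNoetherian (sch F X) where
  toIsLocallyNoetherian := LocallyOfFiniteType.isLocallyNoetherian (str F X)
  toCompactSpace := QuasiCompact.compactSpace_of_compactSpace (str F X)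

instance (X : C) : JacobsonSpace (sch F X) := LocallyOfFiniteType.jacobsonSpace (str F X)

instance {X Y : C} (φ : X ⟶ Y) : LocallyOfFiniteType (mor F φ) := by
  have : LocallyOfFiniteType (mor F φ ≫ str F Y) := by rw [mor_str]; infer_instance
  exact locallyOfFiniteType_of_comp (mor F φ) (str F Y)

theorem mor_id (X : C) : mor F (𝟙 X) = 𝟙 (sch F X) := by simp [mor]

theorem mor_comp {X Y Z : C} (φ : X ⟶ Y) (ψ : Y ⟶ Z) : mor F (φ ≫ ψ) = mor F φ ≫ mor F ψ := by
  simp [mor]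

theorem mor_comp_apply {X Y Z : C} (φ : X ⟶ Y) (ψ : Y ⟶ Z) (t : sch F X) :
    mor F (φ ≫ ψ) t = mor F ψ (mor F φ t) := by
  rw [mor_comp, Scheme.Hom.comp_apply]

theorem range_mor_comp {X Y Z : C} (φ : X ⟶ Y) (ψ : Y ⟶ Z) :
    Set.range (mor F (φ ≫ ψ)) = mor F ψ '' Set.range (mor F φ) := by
  rw [← Set.range_comp]
  exact congrArg Set.range (funext fun t => mor_comp_apply F φ ψ t)

/-- The transcendence degree over `K` of the residue field of a point; by `dim_closure` it is the
dimension of the closure of this point. -/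
noncomputable def pdim {X : C} (t : sch F X) : ℕ := relDim (str F X) t

theorem topologicalKrullDim_closure {X : C} (t : sch F X) :
    topologicalKrullDim (closure {t} : Set (sch F X)) = ((pdim F t : ℕ) : WithBot ℕ∞) := by
  rw [pdim, ← topologicalKrullDim_closure_inter_fiber]
  have : str F X ⁻¹' {str F X t} = Set.univ :=
    Set.eq_univ_of_forall fun s => Subsingleton.elim (α := PrimeSpectrum K) _ _
  rw [this, Set.inter_univ]

theorem dim_eq_of_topologicalKrullDim_eq {T : Type*} [TopologicalSpace T] {A : Set T} {n : ℕ}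
    (h : topologicalKrullDim A = ((n : ℕ) : WithBot ℕ∞)) : dim A = n := by
  rw [dim, h]
  rfl

theorem dim_closure {X : C} (t : sch F X) : dim (closure {t}) = pdim F t :=
  dim_eq_of_topologicalKrullDim_eq (topologicalKrullDim_closure F t)

theorem pdim_eq_add {X Y : C} (φ : X ⟶ Y) (t : sch F X) :
    pdim F t = relDim (mor F φ) t + pdim F (mor F φ t) := by
  have h := relDim_comp (mor F φ) (str F Y) t
  rw [mor_str] at h
  exact h

theorem HasFiniteFibers.pdim_eq {X Y : C} {φ : X ⟶ Y} (h : HasFiniteFibers F φ) (t : sch F X) :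
    pdim F (mor F φ t) = pdim F t := by
  rw [pdim_eq_add F φ t, relDim_eq_zero_of_finite _ _ (h _), zero_add]

theorem HasFiniteFibers.comp {X Y Z : C} {φ : X ⟶ Y} {ψ : Y ⟶ Z} (h : HasFiniteFibers F φ)
    (h' : HasFiniteFibers F ψ) : HasFiniteFibers F (φ ≫ ψ) := by
  intro z
  have : mor F (φ ≫ ψ) ⁻¹' {z} = mor F φ ⁻¹' (mor F ψ ⁻¹' {z}) := by
    ext t
    simp [mor_comp_apply]
  rw [this]
  exact (h' z).preimage' fun y _ => h y

variable {F}

theorem IsSubvariety.exists_eq_closure {X : C} {A : Set (sch F X)} (hA : IsSubvariety A) :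
    ∃ t, A = closure {t} := by
  obtain ⟨t, ht⟩ := QuasiSober.sober hA.1 hA.2
  exact ⟨t, ht.symm⟩

theorem IsSubvariety.topologicalKrullDim_eq_dim {X : C} {A : Set (sch F X)}
    (hA : IsSubvariety A) : ∃ n : ℕ, topologicalKrullDim A = ((n : ℕ) : WithBot ℕ∞) ∧
      dim A = n := by
  obtain ⟨t, rfl⟩ := hA.exists_eq_closure
  exact ⟨_, topologicalKrullDim_closure F t, dim_closure F t⟩

theorem IsSubvariety.dim_le {X : C} {A B : Set (sch F X)} (hA : IsSubvariety A)
    (hB : IsSubvariety B) (h : A ⊆ B) : dim A ≤ dim B := by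
  obtain ⟨n, hn, hn'⟩ := hA.topologicalKrullDim_eq_dim
  obtain ⟨m, hm, hm'⟩ := hB.topologicalKrullDim_eq_dim
  have := topologicalKrullDim_mono h
  rw [hn, hm] at this
  rw [hn', hm']
  exact_mod_cast this

theorem IsSubvariety.eq_of_dim_le {X : C} {A B : Set (sch F X)} (hA : IsSubvariety A)
    (hB : IsSubvariety B) (h : A ⊆ B) (hd : dim B ≤ dim A) : A = B := by
  by_contra hne
  obtain ⟨n, hn, hn'⟩ := hA.topologicalKrullDim_eq_dim
  obtain ⟨m, hm, hm'⟩ := hB.topologicalKrullDim_eq_dim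
  have := topologicalKrullDim_add_one_le hA.2 hB.1 (h.ssubset_of_ne hne)
  rw [hn, hm] at this
  have h1 : n + 1 ≤ m := by exact_mod_cast this
  rw [hn', hm'] at hd
  omega

theorem dim_singleton {T : Type*} [TopologicalSpace T] (t : T) : dim ({t} : Set T) = 0 := by
  have h1 := topologicalKrullDim_zero_of_discreteTopology ({t} : Set T)
  rw [dim]
  have : (topologicalKrullDim ({t} : Set T)).unbotD 0 ≤ 0 := by
    rcases h : topologicalKrullDim ({t} : Set T) with _ | n
    · rfl
    · rw [h] at h1
      exact WithBot.coe_le_coe.mp h1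
  rw [nonpos_iff_eq_zero.mp this]
  rfl

theorem dim_image {T T' : Type u} [TopologicalSpace T] [TopologicalSpace T']
    {f : T → T'} (hf : Topology.IsEmbedding f) (A : Set T) : dim (f '' A) = dim A := by
  rw [dim, dim, topologicalKrullDim_image hf]

theorem closure_image_closure_singleton {X Y : C} (φ : X ⟶ Y) (t : sch F X) :
    closure (mor F φ '' closure {t}) = closure {mor F φ t} := by
  rw [closure_image_closure (mor F φ).continuous, Set.image_singleton]

theorem dim_closure_image_le {X Y : C} (φ : X ⟶ Y) {A : Set (sch F X)} (hA : IsSubvariety A) :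
    dim (closure (mor F φ '' A)) ≤ dim A := by
  obtain ⟨t, rfl⟩ := hA.exists_eq_closure
  rw [closure_image_closure_singleton, dim_closure, dim_closure, pdim_eq_add F φ t]
  push_cast
  omega

theorem dim_closure_image {X Y : C} {φ : X ⟶ Y} (h : HasFiniteFibers F φ) {A : Set (sch F X)}
    (hA : IsSubvariety A) : dim (closure (mor F φ '' A)) = dim A := by
  obtain ⟨t, rfl⟩ := hA.exists_eq_closure
  rw [closure_image_closure_singleton, dim_closure, dim_closure, h.pdim_eq]

/-- In a finite closed subset of a Jacobson space, all points are closed. -/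
theorem isClosed_singleton_of_finite {T : Type*} [TopologicalSpace T] [JacobsonSpace T]
    {A : Set T} (hA : A.Finite) (hc : IsClosed A) {t : T} (ht : t ∈ A) : IsClosed {t} := by
  have := hA.to_subtype
  have : JacobsonSpace A := .of_isClosedEmbedding hc.isClosedEmbedding_subtypeVal
  have h : IsClosed ({⟨t, ht⟩} : Set A) := isClosed_discrete _
  simpa using hc.isClosedEmbedding_subtypeVal.isClosedMap _ h

theorem HasFiniteFibers.isClosed_singleton {X Y : C} {φ : X ⟶ Y} (hφ : HasFiniteFibers F φ)
    {t : sch F X} (h : IsClosed {mor F φ t}) : IsClosed {t} :=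
  isClosed_singleton_of_finite (hφ _) (h.preimage (mor F φ).continuous) rfl

theorem exists_subset_of_subset_sUnion {T : Type*} [TopologicalSpace T] {A : Set T}
    (hA : IsIrreducible A) {𝒞 : Set (Set T)} (hfin : 𝒞.Finite) (hc : ∀ B ∈ 𝒞, IsClosed B)
    (h : A ⊆ ⋃₀ 𝒞) : ∃ B ∈ 𝒞, A ⊆ B := by
  obtain ⟨B, hB, hAB⟩ := isIrreducible_iff_sUnion_isClosed.mp hA hfin.toFinset
    (by simpa using hc) (by simpa using h)
  exact ⟨B, by simpa using hB, hAB⟩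

/-- In a Noetherian space, let a family of closed sets be such that intersections of two members
are finite unions of members. Then an irreducible set contained in some member is contained in a
least one. -/
theorem exists_isLeast_of_inter {T : Type*} [TopologicalSpace T]
    [TopologicalSpace.NoetherianSpace T] {𝒢 : Set (Set T)} (hc : ∀ S ∈ 𝒢, IsClosed S)
    (hinter : ∀ A ∈ 𝒢, ∀ B ∈ 𝒢, ∃ 𝒞 : Set (Set T), 𝒞.Finite ∧ 𝒞 ⊆ 𝒢 ∧ A ∩ B = ⋃₀ 𝒞)
    {V : Set T} (hV : IsIrreducible V) (hne : ∃ S ∈ 𝒢, V ⊆ S) :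
    ∃ S, IsLeast {S | S ∈ 𝒢 ∧ V ⊆ S} S := by
  have hwf : WellFoundedLT (TopologicalSpace.Closeds T) := inferInstance
  obtain ⟨S₁, hS₁, hV₁⟩ := hne
  obtain ⟨S, ⟨hS, hVS⟩, hmin⟩ := hwf.wf.has_min
    {S : TopologicalSpace.Closeds T | (S : Set T) ∈ 𝒢 ∧ V ⊆ S} ⟨⟨S₁, hc _ hS₁⟩, hS₁, hV₁⟩
  refine ⟨S, ⟨hS, hVS⟩, fun A ⟨hA, hVA⟩ => ?_⟩
  obtain ⟨𝒞, hfin, h𝒞, heq⟩ := hinter S hS A hA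
  obtain ⟨B, hB, hVB⟩ := exists_subset_of_subset_sUnion hV hfin (fun B hB => hc B (h𝒞 hB))
    (heq ▸ Set.subset_inter hVS hVA)
  have hBS : B ⊆ S ∩ A := heq ▸ Set.subset_sUnion_of_mem hB
  have := hmin ⟨B, hc B (h𝒞 hB)⟩ ⟨h𝒞 hB, hVB⟩
  by_contra hSA
  refine this (lt_of_le_of_ne (fun b hb => (hBS hb).1) fun h => hSA fun b hb => ?_)
  rw [← h] at hb
  exact (hBS hb).2

end Varieties

/-! ### Slices of products -/

section Slices

variable {K : Type u} [Field K] [IsAlgClosed K] {C : Type v} [Category.{w} C] {F : C ⥤ Variety K}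
  {X Z P : C} {p : P ⟶ Z} {q : P ⟶ X}

/-- The slice `Z × {x}` of a product through a closed point `x`, as a section of the projection to
`Z`. -/
noncomputable def slice (hP : IsProduct F p q) {x : sch F X} (hx : IsClosed {x}) :
    sch F Z ⟶ sch F P :=
  hP.isPullback.lift (𝟙 _) (str F Z ≫ pointOfClosedPoint (str F X) x hx) (by simp)

variable (hP : IsProduct F p q) {x : sch F X} (hx : IsClosed {x})

/-- Base change of the closed point `x : Spec K ⟶ X` along the projection `q`. -/
theorem slice_isPullback : IsPullback (slice hP hx) (str F Z) (mor F q)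
    (pointOfClosedPoint (str F X) x hx) := by
  refine IsPullback.of_right (h₁₂ := mor F p) (v₁₃ := str F Z) (h₂₂ := str F X) ?_
    (by simp [slice]) hP.isPullback
  simpa [slice] using IsPullback.of_horiz_isIso (by simp)

theorem slice_isClosedEmbedding : Topology.IsClosedEmbedding (slice hP hx) := by
  have : IsClosedImmersion (pointOfClosedPoint (str F X) x hx) := by
    have := (F.obj X).property.2.1
    exact isClosedImmersion_of_comp_eq_id (str F X) _ (pointOfClosedPoint_comp _ _ _)
  have : IsClosedImmersion (slice hP hx) :=
    MorphismProperty.of_isPullback (slice_isPullback hP hx).flip this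
  exact (slice hP hx).isClosedEmbedding

theorem fst_slice (z : sch F Z) : mor F p (slice hP hx z) = z := by
  rw [← Scheme.Hom.comp_apply, slice, hP.isPullback.lift_fst]
  rfl

theorem snd_slice (z : sch F Z) : mor F q (slice hP hx z) = x := by
  rw [← Scheme.Hom.comp_apply, slice, hP.isPullback.lift_snd, Scheme.Hom.comp_apply,
    pointOfClosedPoint_apply]

theorem slice_fst {t : sch F P} (ht : mor F q t = x) : slice hP hx (mor F p t) = t := by
  obtain ⟨z, rfl, -⟩ := Scheme.exists_preimage_of_isPullback (slice_isPullback hP hx) t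
    (str F Z (mor F p t)) (by rw [ht, pointOfClosedPoint_apply])
  rw [fst_slice]

/-- A point of a product whose second projection is a closed point is determined by its two
projections. -/
theorem eq_slice {t : sch F P} {z : sch F Z} (hz : mor F p t = z) (ht : mor F q t = x) :
    t = slice hP hx z := by
  rw [← hz, slice_fst hP hx ht]

theorem prodSet_eq_image_slice (A : Set (sch F Z)) :
    prodSet F p q A {x} = slice hP hx '' A := by
  ext t
  constructor
  · rintro ⟨h1, h2⟩
    exact ⟨_, h1, slice_fst hP hx h2⟩
  · rintro ⟨z, hz, rfl⟩
    exact ⟨by simpa [fst_slice] using hz, snd_slice hP hx z⟩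

theorem image_fst_image_slice (A : Set (sch F Z)) : mor F p '' (slice hP hx '' A) = A := by
  rw [Set.image_image]
  simp [fst_slice]

theorem IsSubvariety.image_slice {A : Set (sch F Z)} (hA : IsSubvariety A) :
    IsSubvariety (slice hP hx '' A) :=
  ⟨hA.1.image _ (slice hP hx).continuous.continuousOn,
    (slice_isClosedEmbedding hP hx).isClosedMap _ hA.2⟩

theorem dim_image_slice (A : Set (sch F Z)) : dim (slice hP hx '' A) = dim A :=
  dim_image (slice_isClosedEmbedding hP hx).isEmbedding A

end Slices

/-! ### Special closures -/

section Special

variable {K : Type u} [Field K] {C : Type v} [Category.{w} C] {F : C ⥤ Variety K}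

theorem IsProduct.exists_lift {X Y P : C} {p : P ⟶ X} {q : P ⟶ Y} (hP : IsProduct F p q) {T : C}
    (φ : T ⟶ X) (ψ : T ⟶ Y) : ∃ χ : T ⟶ P, χ ≫ p = φ ∧ χ ≫ q = ψ := by
  obtain ⟨hl⟩ := hP.isLimit
  exact ⟨hl.lift (BinaryFan.mk φ ψ), hl.fac (BinaryFan.mk φ ψ) ⟨WalkingPair.left⟩,
    hl.fac (BinaryFan.mk φ ψ) ⟨WalkingPair.right⟩⟩

/-- The fibered product of `φ` and `ψ` is covered by finitely many distinguished morphisms to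
`X × Y`. -/
theorem IsDistinguished.exists_cover_fiberProduct (hF : IsDistinguished F)
    {X Y P Z : C} {p : P ⟶ X} {q : P ⟶ Y}
    (hP : IsProduct F p q) (φ : X ⟶ Z) (ψ : Y ⟶ Z) :
    ∃ (n : ℕ) (A : Fin n → C) (χ : ∀ i, A i ⟶ P),
      (∀ i a, mor F φ (mor F p (mor F (χ i) a)) = mor F ψ (mor F q (mor F (χ i) a))) ∧
      ∀ x y, mor F φ x = mor F ψ y →
        ∃ i a, mor F p (mor F (χ i) a) = x ∧ mor F q (mor F (χ i) a) = y := by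
  obtain ⟨n, A, χ, h⟩ := hF.fiberedProducts hP φ ψ
  refine ⟨n, A, χ, fun i a => ?_, fun x y hxy => ?_⟩
  · have : mor F (χ i) a ∈ fiberProductSet hP φ ψ := by
      rw [← h]
      exact Set.mem_iUnion_of_mem i ⟨a, rfl⟩
    obtain ⟨s, hs⟩ := this
    rw [← hs]
    rw [← Scheme.Hom.comp_apply, ← Scheme.Hom.comp_apply, ← Scheme.Hom.comp_apply,
      ← Scheme.Hom.comp_apply, IsPullback.lift_fst_assoc, IsPullback.lift_snd_assoc,
      pullback.condition]
  · obtain ⟨s, rfl, rfl⟩ := Scheme.Pullback.exists_preimage_pullback x y hxy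
    have : hP.isPullback.lift (pullback.fst (mor F φ) (mor F ψ)) (pullback.snd (mor F φ) (mor F ψ))
        (fiberProduct_condition φ ψ) s ∈ ⋃ i, Set.range (mor F (χ i)) := by
      rw [h]
      exact ⟨s, rfl⟩
    obtain ⟨i, a, ha⟩ := Set.mem_iUnion.mp this
    refine ⟨i, a, ?_, ?_⟩
    · rw [ha, ← Scheme.Hom.comp_apply, IsPullback.lift_fst]
    · rw [ha, ← Scheme.Hom.comp_apply, IsPullback.lift_snd]

theorem IsSpecial.isSubvariety (hF : IsDistinguished F)
    {Z : C} {S : Set (sch F Z)} (hS : IsSpecial F S) :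
    IsSubvariety S := by
  obtain ⟨Y, φ, rfl⟩ := hS
  refine ⟨?_, (hF.fiberDimension φ).1⟩
  rw [← Set.image_univ]
  exact (IrreducibleSpace.isIrreducible_univ _).image _ (mor F φ).continuous.continuousOn

theorem isSpecial_univ (Z : C) : IsSpecial F (Set.univ : Set (sch F Z)) :=
  ⟨Z, 𝟙 Z, by rw [mor_id]; simp⟩

theorem IsSpecial.image {Y Z : C} {S : Set (sch F Y)} (hS : IsSpecial F S) (φ : Y ⟶ Z) :
    IsSpecial F (mor F φ '' S) := by
  obtain ⟨T, ψ, rfl⟩ := hS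
  exact ⟨T, ψ ≫ φ, (range_mor_comp F ψ φ).symm⟩

/-- Special subvarieties are stable, up to finite unions, under intersections and preimages. -/
theorem IsSpecial.inter_preimage (hF : IsDistinguished F)
    {Y Z : C} {S : Set (sch F Y)} {T : Set (sch F Z)}
    (hS : IsSpecial F S) (hT : IsSpecial F T) (γ : Y ⟶ Z) :
    ∃ 𝒞 : Set (Set (sch F Y)), 𝒞.Finite ∧ 𝒞 ⊆ {A | IsSpecial F A} ∧
      S ∩ mor F γ ⁻¹' T = ⋃₀ 𝒞 := by
  obtain ⟨A, φ, rfl⟩ := hS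
  obtain ⟨B, ψ, rfl⟩ := hT
  obtain ⟨P, p, q, hP⟩ := hF.directProducts A B
  obtain ⟨n, E, χ, h1, h2⟩ := hF.exists_cover_fiberProduct hP (φ ≫ γ) ψ
  refine ⟨Set.range fun i => Set.range (mor F (χ i ≫ p ≫ φ)), Set.finite_range _, ?_, ?_⟩
  · rintro _ ⟨i, rfl⟩
    exact ⟨_, _, rfl⟩
  · ext t
    simp only [Set.sUnion_range, Set.mem_iUnion]
    constructor
    · rintro ⟨⟨a, rfl⟩, ⟨b, hb⟩⟩
      obtain ⟨i, e, he, -⟩ := h2 a b (by rw [mor_comp_apply, hb])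
      exact ⟨i, e, by rw [mor_comp_apply, mor_comp_apply, he]⟩
    · rintro ⟨i, e, rfl⟩
      refine ⟨⟨mor F p (mor F (χ i) e), ?_⟩, ⟨mor F q (mor F (χ i) e), ?_⟩⟩
      · rw [mor_comp_apply, mor_comp_apply]
      · rw [← h1, mor_comp_apply, mor_comp_apply, mor_comp_apply]

theorem isLeast_specialClosure (hF : IsDistinguished F)
    {Z : C} {V : Set (sch F Z)} (hV : IsIrreducible V) :
    IsLeast {S | IsSpecial F S ∧ V ⊆ S} (specialClosure F V) := by
  obtain ⟨S, hS⟩ := exists_isLeast_of_inter (𝒢 := {S | IsSpecial F S})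
    (fun S hS => (hS.isSubvariety hF).2)
    (fun A hA B hB => by simpa [mor_id] using hA.inter_preimage hF hB (𝟙 Z)) hV
    ⟨_, isSpecial_univ Z, Set.subset_univ V⟩
  rwa [specialClosure_eq_of_isLeast F hS]

theorem isSpecial_specialClosure (hF : IsDistinguished F)
    {Z : C} {V : Set (sch F Z)} (hV : IsIrreducible V) :
    IsSpecial F (specialClosure F V) :=
  (isLeast_specialClosure hF hV).1.1

theorem subset_specialClosure {Z : C} (V : Set (sch F Z)) : V ⊆ specialClosure F V :=
  Set.subset_sInter fun _ h => h.2

theorem specialClosure_subset {Z : C} {V S : Set (sch F Z)} (hS : IsSpecial F S) (h : V ⊆ S) :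
    specialClosure F V ⊆ S :=
  Set.sInter_subset_of_mem ⟨hS, h⟩

theorem isSubvariety_specialClosure (hF : IsDistinguished F)
    {Z : C} {V : Set (sch F Z)} (hV : IsIrreducible V) :
    IsSubvariety (specialClosure F V) :=
  (isSpecial_specialClosure hF hV).isSubvariety hF

theorem image_specialClosure (hF : IsDistinguished F)
    {Y Z : C} (γ : Y ⟶ Z) {V : Set (sch F Y)} (hV : IsIrreducible V) :
    mor F γ '' specialClosure F V = specialClosure F (mor F γ '' V) := by
  have hV' : IsIrreducible (mor F γ '' V) := hV.image _ (mor F γ).continuous.continuousOn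
  apply Set.Subset.antisymm
  · obtain ⟨𝒞, hfin, h𝒞, heq⟩ := (isSpecial_specialClosure hF hV).inter_preimage hF
      (isSpecial_specialClosure hF hV') γ
    obtain ⟨B, hB, hVB⟩ := exists_subset_of_subset_sUnion hV hfin
      (fun B hB => ((h𝒞 hB).isSubvariety hF).2) (heq ▸ Set.subset_inter (subset_specialClosure V)
        (Set.image_subset_iff.mp (subset_specialClosure _)))
    have h1 : B ⊆ _ := heq ▸ Set.subset_sUnion_of_mem hB
    rw [Set.image_subset_iff]
    exact (specialClosure_subset (h𝒞 hB) hVB).trans (h1.trans Set.inter_subset_right)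
  · exact specialClosure_subset ((isSpecial_specialClosure hF hV).image γ)
      (Set.image_mono (subset_specialClosure V))

theorem dim_specialClosure_image_le (hF : IsDistinguished F)
    {Y Z : C} (γ : Y ⟶ Z) {V : Set (sch F Y)}
    (hV : IsIrreducible V) :
    dim (specialClosure F (mor F γ '' V)) ≤ dim (specialClosure F V) := by
  have h := isSubvariety_specialClosure hF (hV.image _ (mor F γ).continuous.continuousOn)
  rw [← h.2.closure_eq, ← image_specialClosure hF γ hV]
  exact dim_closure_image_le γ (isSubvariety_specialClosure hF hV)

theorem dim_specialClosure_image (hF : IsDistinguished F)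
    {Y Z : C} {γ : Y ⟶ Z} (hγ : HasFiniteFibers F γ)
    {V : Set (sch F Y)} (hV : IsIrreducible V) :
    dim (specialClosure F (mor F γ '' V)) = dim (specialClosure F V) := by
  have h := isSubvariety_specialClosure hF (hV.image _ (mor F γ).continuous.continuousOn)
  rw [← h.2.closure_eq, ← image_specialClosure hF γ hV]
  exact dim_closure_image hγ (isSubvariety_specialClosure hF hV)

/-- Up to finite morphisms, every distinguished morphism factors as a surjective morphism with
irreducible fibers of constant dimension `d`, followed by a morphism with finite fibers. -/
theorem IsDistinguished.exists_factorization (hF : IsDistinguished F) {X Y : C} (φ : X ⟶ Y) :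
    ∃ (W Z : C) (φ₁ : W ⟶ X) (φ₂ : W ⟶ Z) (φ₃ : Z ⟶ Y) (d : ℕ), φ₁ ≫ φ = φ₂ ≫ φ₃ ∧
      HasFiniteFibers F φ₁ ∧ Function.Surjective (mor F φ₁) ∧ HasFiniteFibers F φ₃ ∧
      Function.Surjective (mor F φ₂) ∧ (∀ z, IsIrreducible (mor F φ₂ ⁻¹' {z})) ∧
      (∀ z, topologicalKrullDim (mor F φ₂ ⁻¹' {z}) = ((d : ℕ) : WithBot ℕ∞)) ∧
      relDim (mor F φ₂) (genericPoint (sch F W)) = d := by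
  obtain ⟨-, W, Z, φ₁, φ₂, φ₃, hcomm, hfin, hsurj, hfin₃, hsurj₂, hirr, d, hd⟩ :=
    hF.fiberDimension φ
  have hdim : ∀ z, topologicalKrullDim (mor F φ₂ ⁻¹' {z}) = d := by
    intro z
    obtain ⟨t, rfl⟩ := hsurj₂ z
    refine topologicalKrullDim_eq_of_localDim_eq ⟨t, rfl⟩ fun s hs => ?_
    have hs' : mor F φ₂ s = mor F φ₂ t := hs
    rw [← hs']
    exact hd s
  have hgen := topologicalKrullDim_closure_inter_fiber (mor F φ₂) (genericPoint (sch F W))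
  rw [genericPoint_closure, Set.univ_inter, hdim] at hgen
  refine ⟨W, Z, φ₁, φ₂, φ₃, _, hcomm, fun y => (mor F φ₁).finite_preimage_singleton y, hsurj,
    hfin₃, hsurj₂, fun z => hirr z (hsurj₂ z), fun z => (hdim z).trans hgen, rfl⟩

theorem IsSpecial.exists_hasFiniteFibers (hF : IsDistinguished F)
    {Z : C} {S : Set (sch F Z)} (hS : IsSpecial F S) :
    ∃ (Y : C) (φ : Y ⟶ Z), HasFiniteFibers F φ ∧ S = Set.range (mor F φ) := by
  obtain ⟨X, φ, rfl⟩ := hS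
  obtain ⟨W, Y, φ₁, φ₂, φ₃, d, hcomm, -, hsurj, hfin, hsurj₂, -⟩ := hF.exists_factorization φ
  refine ⟨Y, φ₃, hfin, ?_⟩
  have h1 := range_mor_comp F φ₁ φ
  have h2 := range_mor_comp F φ₂ φ₃
  rw [hsurj.range_eq, Set.image_univ] at h1
  rw [hsurj₂.range_eq, Set.image_univ] at h2
  rw [← h1, ← h2, hcomm]

theorem relDim_le_of_fiber {X Y : C} {φ : X ⟶ Y} {d : ℕ}
    (h : ∀ z, topologicalKrullDim (mor F φ ⁻¹' {z}) = ((d : ℕ) : WithBot ℕ∞)) (t : sch F X) :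
    relDim (mor F φ) t ≤ d := by
  have h1 := topologicalKrullDim_closure_inter_fiber (mor F φ) t ▸
    topologicalKrullDim_mono (Set.inter_subset_right (s := closure {t})
      (t := mor F φ ⁻¹' {mor F φ t}))
  rw [h] at h1
  exact_mod_cast h1

/-- Along a distinguished morphism `γ`, the difference of the dimensions of the special closures
of a subvariety and of its image does not decrease when the subvariety grows. This is the place
where the constancy of the fiber dimension is used. -/
theorem dim_specialClosure_sub_le (hF : IsDistinguished F)
    {Y Z : C} (γ : Y ⟶ Z) {V U : Set (sch F Y)}
    (hV : IsIrreducible V) (hU : IsIrreducible U) (h : V ⊆ U) :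
    dim (specialClosure F V) - dim (specialClosure F (mor F γ '' V)) ≤
      dim (specialClosure F U) - dim (specialClosure F (mor F γ '' U)) := by
  obtain ⟨A, ρ, hρ, hUρ⟩ := (isSpecial_specialClosure hF hU).exists_hasFiniteFibers hF
  obtain ⟨W, T, φ₁, φ₂, φ₃, d, hcomm, hfin₁, hsurj₁, hfin₃, hsurj₂, -, hdim, hd⟩ :=
    hF.exists_factorization (ρ ≫ γ)
  -- A point of `W` over the generic point of a set `S` computes both dimensions.
  have key : ∀ (S : Set (sch F Y)) (e : sch F W), IsIrreducible S →
      specialClosure F S = closure {mor F (φ₁ ≫ ρ) e} →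
      dim (specialClosure F S) - dim (specialClosure F (mor F γ '' S)) =
        relDim (mor F φ₂) e := by
    intro S e hS he
    have hS' : IsIrreducible (mor F γ '' S) := hS.image _ (mor F γ).continuous.continuousOn
    have h1 : specialClosure F (mor F γ '' S) = closure {mor F φ₃ (mor F φ₂ e)} := by
      rw [← (isSubvariety_specialClosure hF hS').2.closure_eq, ← image_specialClosure hF γ hS, he,
        closure_image_closure_singleton, ← mor_comp_apply, ← mor_comp_apply, Category.assoc, hcomm]
    rw [h1, he, dim_closure, dim_closure, (hfin₁.comp F hρ).pdim_eq, hfin₃.pdim_eq,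
      pdim_eq_add F φ₂]
    push_cast
    ring
  have hrange : specialClosure F U = Set.range (mor F (φ₁ ≫ ρ)) := by
    rw [hUρ, range_mor_comp, hsurj₁.range_eq, Set.image_univ]
  obtain ⟨v, hv⟩ := (isSubvariety_specialClosure hF hV).exists_eq_closure
  have hvU : v ∈ specialClosure F U := by
    refine specialClosure_subset (isSpecial_specialClosure hF hU)
      (h.trans (subset_specialClosure U)) ?_
    rw [hv]
    exact subset_closure rfl
  rw [hrange] at hvU
  obtain ⟨e, rfl⟩ := hvU
  rw [key V e hV hv, key U (genericPoint (sch F W)) hU ?_, hd]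
  · exact_mod_cast relDim_le_of_fiber hdim e
  · rw [← closure_image_closure_singleton, genericPoint_closure, Set.image_univ, ← hrange,
      (isSubvariety_specialClosure hF hU).2.closure_eq]

end Special

/-! ### Weakly special closures -/

section WeaklySpecial

variable {K : Type u} [Field K] {C : Type v} [Category.{w} C] {F : C ⥤ Variety K}

theorem IsComponentOf.mem_of_eq_sUnion {T : Type*} [TopologicalSpace T] {W S : Set T}
    (hW : IsComponentOf W S) {𝒞 : Set (Set T)} (hfin : 𝒞.Finite)
    (h : ∀ B ∈ 𝒞, IsSubvariety B) (hS : S = ⋃₀ 𝒞) : W ∈ 𝒞 := by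
  obtain ⟨B, hB, hWB⟩ := exists_subset_of_subset_sUnion hW.prop.1 hfin (fun B hB => (h B hB).2)
    (hS ▸ hW.prop.2)
  rwa [hW.eq_of_le ⟨(h B hB).1, hS ▸ Set.subset_sUnion_of_mem hB⟩ hWB]

/-- The image of a fiber is a finite union of images of irreducible fibers. -/
theorem exists_image_fiber_eq_sUnion (hF : IsDistinguished F) {X Y Z : C} (φ : Y ⟶ Z)
    (ψ : Y ⟶ X) {x : sch F X} (hx : IsClosed {x}) :
    ∃ 𝒞 : Set (Set (sch F Z)), 𝒞.Finite ∧
      (∀ B ∈ 𝒞, ∃ (W T : C) (φ' : W ⟶ Z) (ψ' : W ⟶ T) (t : sch F T), IsClosed {t} ∧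
        IsIrreducible (mor F ψ' ⁻¹' {t}) ∧ B = mor F φ' '' (mor F ψ' ⁻¹' {t})) ∧
      mor F φ '' (mor F ψ ⁻¹' {x}) = ⋃₀ 𝒞 := by
  obtain ⟨W, T, φ₁, φ₂, φ₃, d, hcomm, hfin₁, hsurj₁, hfin₃, hsurj₂, hirr, -⟩ :=
    hF.exists_factorization ψ
  refine ⟨(fun t => mor F (φ₁ ≫ φ) '' (mor F φ₂ ⁻¹' {t})) '' (mor F φ₃ ⁻¹' {x}),
    (hfin₃ x).image _, ?_, ?_⟩
  · rintro _ ⟨t, rfl, rfl⟩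
    exact ⟨W, T, φ₁ ≫ φ, φ₂, t, hfin₃.isClosed_singleton hx, hirr t, rfl⟩
  · ext z
    simp only [Set.sUnion_image, Set.mem_iUnion]
    constructor
    · rintro ⟨y, hy, rfl⟩
      obtain ⟨a, rfl⟩ := hsurj₁ y
      refine ⟨mor F φ₂ a, ?_, a, rfl, mor_comp_apply F φ₁ φ a⟩
      rw [Set.mem_preimage, ← mor_comp_apply, ← hcomm, mor_comp_apply]
      exact hy
    · rintro ⟨t, ht, a, rfl, rfl⟩
      refine ⟨mor F φ₁ a, ?_, (mor_comp_apply F φ₁ φ a).symm⟩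
      rw [Set.mem_preimage, ← mor_comp_apply, hcomm, mor_comp_apply]
      exact ht

variable [IsAlgClosed K]

/-- The image of a fiber over a closed point is closed, since it is a slice of the image of a
morphism to a product. -/
theorem isClosed_image_fiber (hF : IsDistinguished F) {X Y Z : C} (φ : Y ⟶ Z) (ψ : Y ⟶ X)
    {x : sch F X} (hx : IsClosed {x}) : IsClosed (mor F φ '' (mor F ψ ⁻¹' {x})) := by
  obtain ⟨P, p, q, hP⟩ := hF.directProducts Z X
  obtain ⟨χ, rfl, rfl⟩ := hP.exists_lift φ ψ
  have : mor F (χ ≫ p) '' (mor F (χ ≫ q) ⁻¹' {x}) = slice hP hx ⁻¹' Set.range (mor F χ) := by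
    ext z
    constructor
    · rintro ⟨t, ht, rfl⟩
      refine ⟨t, eq_slice hP hx (mor_comp_apply F χ p t).symm ?_⟩
      rw [← mor_comp_apply]
      exact ht
    · rintro ⟨t, ht⟩
      refine ⟨t, ?_, ?_⟩
      · rw [Set.mem_preimage, mor_comp_apply, ht, snd_slice]
        rfl
      · rw [mor_comp_apply, ht, fst_slice]
  rw [this]
  exact (hF.fiberDimension χ).1.preimage (slice hP hx).continuous

theorem isSubvariety_image_fiber (hF : IsDistinguished F) {X Y Z : C} (φ : Y ⟶ Z) (ψ : Y ⟶ X)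
    {x : sch F X} (hx : IsClosed {x}) (hirr : IsIrreducible (mor F ψ ⁻¹' {x})) :
    IsSubvariety (mor F φ '' (mor F ψ ⁻¹' {x})) :=
  ⟨hirr.image _ (mor F φ).continuous.continuousOn, isClosed_image_fiber hF φ ψ hx⟩

theorem IsSubvariety.isComponentOf_self {T : Type*} [TopologicalSpace T] {W : Set T}
    (hW : IsSubvariety W) : IsComponentOf W W :=
  ⟨⟨hW.1, subset_rfl⟩, fun _ h _ => h.2⟩

theorem isWeaklySpecial_image_fiber (hF : IsDistinguished F) {X Y Z : C} (φ : Y ⟶ Z) (ψ : Y ⟶ X)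
    {x : sch F X} (hx : IsClosed {x}) (hirr : IsIrreducible (mor F ψ ⁻¹' {x})) :
    IsWeaklySpecial F (mor F φ '' (mor F ψ ⁻¹' {x})) :=
  ⟨isSubvariety_image_fiber hF φ ψ hx hirr, Y, X, ψ, φ, x, hx,
    (isSubvariety_image_fiber hF φ ψ hx hirr).isComponentOf_self⟩

/-- A weakly special subvariety is the whole image of an irreducible fiber, and not only a component
of the image of a fiber. -/
theorem IsWeaklySpecial.exists_eq_image_fiber (hF : IsDistinguished F) {Z : C}
    {W : Set (sch F Z)} (hW : IsWeaklySpecial F W) :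
    ∃ (Y X : C) (φ : Y ⟶ Z) (ψ : Y ⟶ X) (x : sch F X), IsClosed {x} ∧
      IsIrreducible (mor F ψ ⁻¹' {x}) ∧ W = mor F φ '' (mor F ψ ⁻¹' {x}) := by
  obtain ⟨-, Y, X, ψ, φ, x, hx, hcomp⟩ := hW
  obtain ⟨𝒞, hfin, h𝒞, heq⟩ := exists_image_fiber_eq_sUnion hF φ ψ hx
  refine h𝒞 W (hcomp.mem_of_eq_sUnion hfin (fun B hB => ?_) heq)
  obtain ⟨Y', X', φ', ψ', x', hx', hirr, rfl⟩ := h𝒞 B hB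
  exact isSubvariety_image_fiber hF φ' ψ' hx' hirr

/-- Weakly special subvarieties are stable, up to finite unions, under intersections. -/
theorem IsWeaklySpecial.inter (hF : IsDistinguished F) {Z : C} {A B : Set (sch F Z)}
    (hA : IsWeaklySpecial F A) (hB : IsWeaklySpecial F B) :
    ∃ 𝒞 : Set (Set (sch F Z)), 𝒞.Finite ∧ 𝒞 ⊆ {A | IsWeaklySpecial F A} ∧ A ∩ B = ⋃₀ 𝒞 := by
  obtain ⟨Y₁, X₁, φ₁, ψ₁, x₁, hx₁, -, rfl⟩ := hA.exists_eq_image_fiber hF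
  obtain ⟨Y₂, X₂, φ₂, ψ₂, x₂, hx₂, -, rfl⟩ := hB.exists_eq_image_fiber hF
  obtain ⟨P, p, q, hP⟩ := hF.directProducts Y₁ Y₂
  obtain ⟨Q, a, b, hQ⟩ := hF.directProducts X₁ X₂
  obtain ⟨n, E, χ, h1, h2⟩ := hF.exists_cover_fiberProduct hP φ₁ φ₂
  obtain ⟨ψ, hψ₁, hψ₂⟩ := hQ.exists_lift (p ≫ ψ₁) (q ≫ ψ₂)
  have hx : IsClosed {slice hQ hx₂ x₁} := by
    simpa using (slice_isClosedEmbedding hQ hx₂).isClosedMap _ hx₁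
  choose 𝒞 hfin h𝒞 heq using fun i =>
    exists_image_fiber_eq_sUnion hF (χ i ≫ p ≫ φ₁) (χ i ≫ ψ) hx
  refine ⟨⋃ i, 𝒞 i, Set.finite_iUnion hfin, ?_, ?_⟩
  · intro B hB
    obtain ⟨i, hi⟩ := Set.mem_iUnion.mp hB
    obtain ⟨Y', X', φ', ψ', x', hx', hirr, rfl⟩ := h𝒞 i B hi
    exact isWeaklySpecial_image_fiber hF φ' ψ' hx' hirr
  · rw [Set.sUnion_iUnion]
    simp_rw [← heq]
    ext z
    simp only [Set.mem_iUnion]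
    constructor
    · rintro ⟨⟨y₁, hy₁, rfl⟩, ⟨y₂, hy₂, hz⟩⟩
      obtain ⟨i, e, rfl, rfl⟩ := h2 y₁ y₂ hz.symm
      refine ⟨i, e, ?_, by simp only [mor_comp_apply]⟩
      rw [Set.mem_preimage, mor_comp_apply]
      refine eq_slice hQ hx₂ ?_ ?_
      · rw [← mor_comp_apply, hψ₁, mor_comp_apply]
        exact hy₁
      · rw [← mor_comp_apply, hψ₂, mor_comp_apply]
        exact hy₂
    · rintro ⟨i, e, he, rfl⟩
      have he' : mor F ψ (mor F (χ i) e) = slice hQ hx₂ x₁ := by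
        rw [← mor_comp_apply]
        exact he
      refine ⟨⟨mor F p (mor F (χ i) e), ?_, ?_⟩, ⟨mor F q (mor F (χ i) e), ?_, ?_⟩⟩
      · rw [Set.mem_preimage, ← mor_comp_apply, ← hψ₁, mor_comp_apply, he', fst_slice]
        rfl
      · simp only [mor_comp_apply]
      · rw [Set.mem_preimage, ← mor_comp_apply, ← hψ₂, mor_comp_apply, he', snd_slice]
        rfl
      · simp only [← h1, mor_comp_apply]

theorem isWeaklySpecial_univ (hF : IsDistinguished F) (Z : C) :
    IsWeaklySpecial F (Set.univ : Set (sch F Z)) := by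
  obtain ⟨T, ⟨hT⟩, hiso⟩ := hF.finalObject
  have hsub : Subsingleton (sch F T) :=
    (str F T).isOpenEmbedding.injective.subsingleton (β := PrimeSpectrum K)
  have hx : IsClosed ({genericPoint (sch F T)} : Set (sch F T)) := by
    rw [Set.eq_univ_of_forall (s := {genericPoint (sch F T)}) fun t => Subsingleton.elim _ _]
    exact isClosed_univ
  have h : mor F (hT.from Z) ⁻¹' {genericPoint (sch F T)} = Set.univ :=
    Set.eq_univ_of_forall fun t => Subsingleton.elim _ _
  have := isWeaklySpecial_image_fiber hF (𝟙 Z) (hT.from Z) hx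
    (h ▸ IrreducibleSpace.isIrreducible_univ _)
  rw [h, mor_id] at this
  simpa using this

theorem isLeast_weaklySpecialClosure (hF : IsDistinguished F) {Z : C} {V : Set (sch F Z)}
    (hV : IsIrreducible V) :
    IsLeast {S | IsWeaklySpecial F S ∧ V ⊆ S} (weaklySpecialClosure F V) := by
  obtain ⟨S, hS⟩ := exists_isLeast_of_inter (𝒢 := {S | IsWeaklySpecial F S})
    (fun S hS => hS.1.2) (fun A hA B hB => hA.inter hF hB) hV
    ⟨_, isWeaklySpecial_univ hF Z, Set.subset_univ V⟩
  rwa [weaklySpecialClosure_eq_of_isLeast F hS]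

/-! ### Special closures in a slice of a product -/

/-- The special closure of `W × {y}` in `Z × Y` has the dimension of the product of `⟨y⟩` and a
`Σ`-special subvariety `B` containing `W`, where `Σ` is the `Σ`-orbit of `y`. Indeed, a finite cover
of this special closure is a family of irreducible varieties of constant dimension over a finite
cover of `⟨y⟩`, and `B` is the image of its fiber over a suitable point above `y`. -/
theorem exists_isSigmaSpecial (hF : IsDistinguished F) {Z Y P : C} {p : P ⟶ Z} {q : P ⟶ Y}
    (hP : IsProduct F p q) {y : sch F Y} (hy : IsClosed {y}) {W : Set (sch F Z)}
    (hW : IsIrreducible W) :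
    ∃ B : Set (sch F Z), IsSigmaSpecial (sigmaOrbit F y) B ∧ W ⊆ B ∧
      slice hP hy '' B ⊆ specialClosure F (slice hP hy '' W) ∧
      dim (specialClosure F (slice hP hy '' W)) = dim B + dim (specialClosure F {y}) := by
  have hW' : IsIrreducible (slice hP hy '' W) := hW.image _ (slice hP hy).continuous.continuousOn
  obtain ⟨A, ρ, hρ, hrange⟩ := (isSpecial_specialClosure hF hW').exists_hasFiniteFibers hF
  obtain ⟨T, S, φ₁, φ₂, φ₃, d, hcomm, hfin₁, hsurj₁, hfin₃, hsurj₂, hirr, hdim, hd⟩ :=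
    hF.exists_factorization (ρ ≫ q)
  let χ := φ₁ ≫ ρ
  have hχ : HasFiniteFibers F χ := hfin₁.comp F hρ
  have hrangeχ : specialClosure F (slice hP hy '' W) = Set.range (mor F χ) := by
    rw [hrange, range_mor_comp, hsurj₁.range_eq, Set.image_univ]
  have hχq : ∀ t, mor F q (mor F χ t) = mor F φ₃ (mor F φ₂ t) := fun t => by
    rw [← mor_comp_apply, ← mor_comp_apply, Category.assoc, hcomm]
  have hS : ∀ s ∈ mor F φ₃ ⁻¹' {y}, IsClosed {s} := fun s hs =>
    hfin₃.isClosed_singleton (by rwa [Set.mem_preimage.mp hs])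
  -- Among the finitely many irreducible pieces of the fiber over `y`, one contains `W × {y}`.
  obtain ⟨_, ⟨s, hs, rfl⟩, hWs⟩ := exists_subset_of_subset_sUnion hW'
    ((hfin₃ y).image fun s => mor F χ '' (mor F φ₂ ⁻¹' {s}))
    (by
      rintro _ ⟨s, hs, rfl⟩
      exact isClosed_image_fiber hF χ φ₂ (hS s hs))
    (by
      intro t ht
      obtain ⟨a, rfl⟩ : t ∈ Set.range (mor F χ) := hrangeχ ▸ subset_specialClosure _ ht
      have hq : mor F q (mor F χ a) = y := by
        obtain ⟨z, -, hz⟩ := ht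
        rw [← hz, snd_slice]
      rw [Set.sUnion_image, Set.mem_iUnion₂]
      exact ⟨mor F φ₂ a, (hχq a).symm.trans hq, a, rfl, rfl⟩)
  have hslice : slice hP hy '' (mor F (χ ≫ p) '' (mor F φ₂ ⁻¹' {s})) =
      mor F χ '' (mor F φ₂ ⁻¹' {s}) := by
    rw [Set.image_image]
    refine Set.image_congr fun t ht => ?_
    rw [mor_comp_apply]
    refine slice_fst hP hy ?_
    rw [hχq, Set.mem_preimage.mp ht]
    exact hs
  refine ⟨mor F (χ ≫ p) '' (mor F φ₂ ⁻¹' {s}),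
    ⟨isWeaklySpecial_image_fiber hF _ _ (hS s hs) (hirr s), T, S, χ ≫ p, φ₂, s, ?_,
      (isSubvariety_image_fiber hF _ _ (hS s hs) (hirr s)).isComponentOf_self⟩, ?_, ?_, ?_⟩
  · exact ⟨S, 𝟙 S, φ₃, s, hS s hs, hfin₃, hs, by simp [mor_id]⟩
  · rw [← image_fst_image_slice hP hy W]
    refine (Set.image_mono hWs).trans ?_
    rintro _ ⟨_, ⟨t, ht, rfl⟩, rfl⟩
    exact ⟨t, ht, mor_comp_apply F χ p t⟩
  · rw [hslice, hrangeχ]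
    exact Set.image_subset_range _ _
  · have hB : dim (mor F (χ ≫ p) '' (mor F φ₂ ⁻¹' {s})) = d := by
      have hsub : IsSubvariety (mor F φ₂ ⁻¹' {s}) :=
        ⟨hirr s, (hS s hs).preimage (mor F φ₂).continuous⟩
      rw [← dim_image_slice hP hy, hslice, ← (isClosed_image_fiber hF χ φ₂ (hS s hs)).closure_eq,
        dim_closure_image hχ hsub, dim_eq_of_topologicalKrullDim_eq (hdim s)]
    let ξ := genericPoint (sch F T)
    have h1 : specialClosure F (slice hP hy '' W) = closure {mor F χ ξ} := by
      rw [← closure_image_closure_singleton, genericPoint_closure, Set.image_univ, ← hrangeχ,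
        (isSubvariety_specialClosure hF hW').2.closure_eq]
    have h2 : specialClosure F {y} = closure {mor F φ₃ (mor F φ₂ ξ)} := by
      have himg : mor F q '' (slice hP hy '' W) = {y} := by
        rw [Set.image_image]
        simp only [snd_slice]
        exact hW.nonempty.image_const y
      rw [← hχq, ← closure_image_closure_singleton q, ← h1, image_specialClosure hF q hW', himg,
        (isSubvariety_specialClosure hF isIrreducible_singleton).2.closure_eq]
    rw [h1, h2, hB, dim_closure, dim_closure, hχ.pdim_eq, hfin₃.pdim_eq, pdim_eq_add F φ₂, hd]
    push_cast
    ring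

/-- If the weakly special closure of `W` comes from a fiber over the image of `y`, then the special
closure of `W × {y}` has the dimension of a product. -/
theorem dim_specialClosure_slice (hF : IsDistinguished F) {Z Y P : C} {p : P ⟶ Z} {q : P ⟶ Y}
    (hP : IsProduct F p q) {y : sch F Y} (hy : IsClosed {y}) {W : Set (sch F Z)}
    (hW : IsIrreducible W) {R X : C} (ψ : R ⟶ Z) (φ : R ⟶ X) (α : Y ⟶ X)
    (h : IsComponentOf (weaklySpecialClosure F W) (mor F ψ '' (mor F φ ⁻¹' {mor F α y}))) :
    dim (specialClosure F (slice hP hy '' W)) =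
      dim (weaklySpecialClosure F W) + dim (specialClosure F {y}) := by
  have hW' : IsIrreducible (slice hP hy '' W) := hW.image _ (slice hP hy).continuous.continuousOn
  obtain ⟨B, hB, hWB, hBS, hdim⟩ := exists_isSigmaSpecial hF hP hy hW
  obtain ⟨Q, a, b, hQ⟩ := hF.directProducts R Y
  obtain ⟨n, E, χ, h1, h2⟩ := hF.exists_cover_fiberProduct hQ φ α
  obtain ⟨θ, hθ₁, hθ₂⟩ := hP.exists_lift (a ≫ ψ) b
  -- The special closure of `W × {y}` lies in the image of the fibered product of `φ` and `α`.
  obtain ⟨_, ⟨i, rfl⟩, hi⟩ := exists_subset_of_subset_sUnion hW'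
    (Set.finite_range fun i => Set.range (mor F (χ i ≫ θ)))
    (by
      rintro _ ⟨i, rfl⟩
      exact (hF.fiberDimension _).1)
    (by
      rintro _ ⟨z, hz, rfl⟩
      obtain ⟨r, hr, hrz⟩ := h.prop.2 ((isLeast_weaklySpecialClosure hF hW).1.2 hz)
      obtain ⟨i, e, he₁, he₂⟩ := h2 r y hr
      rw [Set.sUnion_range, Set.mem_iUnion]
      refine ⟨i, e, eq_slice hP hy ?_ ?_⟩
      · rw [mor_comp_apply, ← mor_comp_apply F θ, hθ₁, mor_comp_apply, he₁, hrz]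
      · rw [mor_comp_apply, ← mor_comp_apply F θ, hθ₂, he₂])
  have hBsub : B ⊆ mor F ψ '' (mor F φ ⁻¹' {mor F α y}) := by
    intro z hz
    obtain ⟨e, he⟩ := specialClosure_subset ⟨_, _, rfl⟩ hi (hBS (Set.mem_image_of_mem _ hz))
    have h3 : mor F b (mor F (χ i) e) = y := by
      rw [← hθ₂, mor_comp_apply, ← mor_comp_apply F (χ i), he, snd_slice]
    refine ⟨mor F a (mor F (χ i) e), ?_, ?_⟩
    · rw [Set.mem_preimage, h1, h3]
      rfl
    · rw [← mor_comp_apply, ← hθ₁, mor_comp_apply, ← mor_comp_apply F (χ i), he, fst_slice]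
  have hle : weaklySpecialClosure F W ⊆ B := (isLeast_weaklySpecialClosure hF hW).2 ⟨hB.1, hWB⟩
  rw [hdim, h.eq_of_le ⟨hB.1.1.1, hBsub⟩ hle]

theorem dim_add_le_dim_specialClosure_slice (hF : IsDistinguished F) {Z Y P : C} {p : P ⟶ Z}
    {q : P ⟶ Y} (hP : IsProduct F p q) {y : sch F Y} (hy : IsClosed {y}) {W : Set (sch F Z)}
    (hW : IsIrreducible W) :
    dim (weaklySpecialClosure F W) + dim (specialClosure F {y}) ≤
      dim (specialClosure F (slice hP hy '' W)) := by
  obtain ⟨B, hB, hWB, -, hdim⟩ := exists_isSigmaSpecial hF hP hy hW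
  have hl := isLeast_weaklySpecialClosure hF hW
  have := hl.1.1.1.dim_le hB.1.1 (hl.2 ⟨hB.1, hWB⟩)
  omega

/-- For a morphism `β` with `β(y) = x`, the morphism `id × β` maps `W × {y}` to `W × {x}`. -/
theorem exists_prod_map {Z Y X P P' : C} {p : P ⟶ Z} {q : P ⟶ X} (hP : IsProduct F p q)
    {p' : P' ⟶ Z} {q' : P' ⟶ Y} (hP' : IsProduct F p' q') {y : sch F Y} (hy : IsClosed {y})
    {x : sch F X} (hx : IsClosed {x}) (β : Y ⟶ X) (h : mor F β y = x) :
    ∃ γ : P' ⟶ P, ∀ W : Set (sch F Z),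
      mor F γ '' (slice hP' hy '' W) = slice hP hx '' W := by
  obtain ⟨γ, hγ₁, hγ₂⟩ := hP.exists_lift p' (q' ≫ β)
  refine ⟨γ, fun W => ?_⟩
  rw [Set.image_image]
  refine Set.image_congr fun z _ => eq_slice hP hx ?_ ?_
  · rw [← mor_comp_apply, hγ₁, fst_slice]
  · rw [← mor_comp_apply, hγ₂, mor_comp_apply, snd_slice, h]

/-- The numerical criterion: the weakly special closure of `W` is `Σ`-special if and only if
the special closure of `W × {x}` has the dimension of a product. -/
theorem isSigmaSpecial_weaklySpecialClosure_iff (hF : IsDistinguished F) {Z X P : C} {p : P ⟶ Z}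
    {q : P ⟶ X} (hP : IsProduct F p q) {x : sch F X} (hx : IsClosed {x}) {W : Set (sch F Z)}
    (hW : IsIrreducible W) :
    IsSigmaSpecial (sigmaOrbit F x) (weaklySpecialClosure F W) ↔
      dim (specialClosure F (slice hP hx '' W)) =
        dim (weaklySpecialClosure F W) + dim (specialClosure F {x}) := by
  have hl := isLeast_weaklySpecialClosure hF hW
  constructor
  · rintro ⟨-, R, X', ψ, φ, _, ⟨Y, α, β, y, hy, hβ, hyx, rfl⟩, hcomp⟩
    refine le_antisymm ?_ (dim_add_le_dim_specialClosure_slice hF hP hx hW)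
    obtain ⟨P', p', q', hP'⟩ := hF.directProducts Z Y
    obtain ⟨γ, hγ⟩ := exists_prod_map hP hP' hy hx β hyx
    have h1 := dim_specialClosure_slice hF hP' hy hW ψ φ α hcomp
    have h2 := dim_specialClosure_image_le hF γ
      (hW.image _ (slice hP' hy).continuous.continuousOn)
    have h3 := dim_specialClosure_image hF hβ (V := {y}) isIrreducible_singleton
    rw [hγ] at h2
    rw [Set.image_singleton, hyx] at h3
    omega
  · intro h
    obtain ⟨B, hB, hWB, -, hdim⟩ := exists_isSigmaSpecial hF hP hx hW
    rwa [hl.1.1.1.eq_of_dim_le hB.1.1 (hl.2 ⟨hB.1, hWB⟩) (by omega)]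

/-- If the weakly special closure of `W` is `Σ`-special, then so is that of every subvariety that
contains `W`. The closure of `U` comes from the fiber over a point `t` of some `T`; over
`X × T`, both closures are compared at `(x, t)`, and the projection to `X` is controlled by
`dim_specialClosure_sub_le`. -/
theorem isSigmaSpecial_weaklySpecialClosure_of_subset (hF : IsDistinguished F) {Z X : C}
    {x : sch F X} (hx : IsClosed {x}) {W U : Set (sch F Z)} (hW : IsIrreducible W)
    (hU : IsIrreducible U) (hWU : W ⊆ U)
    (h : IsSigmaSpecial (sigmaOrbit F x) (weaklySpecialClosure F W)) :
    IsSigmaSpecial (sigmaOrbit F x) (weaklySpecialClosure F U) := by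
  obtain ⟨P, p, q, hP⟩ := hF.directProducts Z X
  rw [isSigmaSpecial_weaklySpecialClosure_iff hF hP hx hW] at h
  rw [isSigmaSpecial_weaklySpecialClosure_iff hF hP hx hU]
  obtain ⟨-, R, T, φ, ψ, t, ht, hcomp⟩ := (isLeast_weaklySpecialClosure hF hU).1.1
  obtain ⟨Y, β, π, hY⟩ := hF.directProducts X T
  have hy : IsClosed {slice hY ht x} := by
    simpa using (slice_isClosedEmbedding hY ht).isClosedMap _ hx
  obtain ⟨P', p', q', hP'⟩ := hF.directProducts Z Y
  obtain ⟨γ, hγ⟩ := exists_prod_map hP hP' hy hx β (fst_slice hY ht x)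
  have h1 := dim_specialClosure_slice hF hP' hy hU ψ φ π (by rwa [snd_slice])
  have h2 := dim_add_le_dim_specialClosure_slice hF hP' hy hW
  have h3 := dim_specialClosure_sub_le hF γ (hW.image _ (slice hP' hy).continuous.continuousOn)
    (hU.image _ (slice hP' hy).continuous.continuousOn) (Set.image_mono hWU)
  have h4 := dim_add_le_dim_specialClosure_slice hF hP hx hU
  rw [hγ, hγ] at h3
  omega

end WeaklySpecial

/-! ### Atypical and optimal subvarieties -/

section Atypical

variable {K : Type u} [Field K] [IsAlgClosed K] {C : Type v} [Category.{w} C] {F : C ⥤ Variety K}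

/-- A subvariety of `V` that strictly contains a maximal `Σ`-atypical one has a larger weak defect,
and its weakly special closure is `Σ`-special. -/
theorem IsMaximalSigmaAtypical.weakDefect_lt (hF : IsDistinguished F) {X Z : C} {x : sch F X}
    (hx : IsClosed {x}) {V W U : Set (sch F Z)}
    (hW : IsMaximalSigmaAtypical (sigmaOrbit F x) V W) (hU : IsSubvariety U) (hWU : W ⊂ U)
    (hUV : U ⊆ V) : IsSigmaSpecial (sigmaOrbit F x) (weaklySpecialClosure F U) ∧
      weakDefect F W < weakDefect F U := by
  have hsigma := isSigmaSpecial_weaklySpecialClosure_of_subset hF hx hW.prop.1.1.1 hU.1 hWU.1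
    hW.prop.1.2.2
  refine ⟨hsigma, ?_⟩
  by_contra! h
  exact hWU.2 (hW.2 ⟨⟨hU, hUV, hsigma⟩, h.trans_lt hW.prop.2⟩ hWU.1)

theorem isSigmaSpecial_weaklySpecialClosure_iff_defect (hF : IsDistinguished F) {Z X P : C}
    {p : P ⟶ Z} {q : P ⟶ X} (hP : IsProduct F p q) {x : sch F X} (hx : IsClosed {x})
    {W : Set (sch F Z)} (hW : IsIrreducible W) :
    IsSigmaSpecial (sigmaOrbit F x) (weaklySpecialClosure F W) ↔
      defect F (slice hP hx '' W) - weakDefect F W = defect F {x} := by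
  rw [isSigmaSpecial_weaklySpecialClosure_iff hF hP hx hW, defect, weakDefect, defect,
    dim_image_slice, dim_singleton]
  omega

end Atypical

end Distinguished

theorem mainTheorem6 {K : Type*} [Field K] [IsAlgClosed K] [CharZero K]
    {C : Type*} [Category C] (F : C ⥤ Distinguished.Variety K)
    (hF : Distinguished.IsDistinguished F)
    {X Z P : C} (p : P ⟶ Z) (q : P ⟶ X) (hP : Distinguished.IsProduct F p q)
    (x : Distinguished.sch F X) (hx : IsClosed {x})
    (V : Set (Distinguished.sch F Z)) (hV : Distinguished.IsSubvariety V) :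
    (∀ W : Set (Distinguished.sch F Z), Distinguished.IsSubvariety W → W ⊆ V →
      (Distinguished.IsSigmaSubvariety (Distinguished.sigmaOrbit F x) V W ↔
        Distinguished.defect F (Distinguished.prodSet F p q W {x}) -
            Distinguished.weakDefect F W =
          Distinguished.defect F {x})) ∧
    (∀ W : Set (Distinguished.sch F Z),
      Distinguished.IsMaximalSigmaAtypical (Distinguished.sigmaOrbit F x) V W →
        Distinguished.IsOptimal F (Distinguished.prodSet F p q V {x})
          (Distinguished.prodSet F p q W {x})) ∧
    (∀ W : Set (Distinguished.sch F Z),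
      Distinguished.IsMaximalSigmaAtypical (Distinguished.sigmaOrbit F x) V W →
        Distinguished.IsWeaklyOptimal F V W) := by
  open Distinguished in
  refine ⟨fun W hW hWV => ?_, fun W hW => ⟨?_, ?_, fun U' hU' hWU' hUV' => ?_⟩,
    fun W hW => ⟨hW.prop.1.1, hW.prop.1.2.1, fun U hU hWU hUV =>
      (hW.weakDefect_lt hF hx hU hWU hUV).2⟩⟩
  · rw [prodSet_eq_image_slice hP hx,
      ← isSigmaSpecial_weaklySpecialClosure_iff_defect hF hP hx hW.1]
    exact ⟨fun h => h.2.2, fun h => ⟨hW, hWV, h⟩⟩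
  · rw [prodSet_eq_image_slice hP hx]
    exact hW.prop.1.1.image_slice hP hx
  · rw [prodSet_eq_image_slice hP hx, prodSet_eq_image_slice hP hx]
    exact Set.image_mono hW.prop.1.2.1
  · rw [prodSet_eq_image_slice hP hx] at hUV' hWU' ⊢
    -- Every subvariety of `V × {x}` has the form `U × {x}`.
    obtain ⟨U, hUV, rfl⟩ := Set.subset_image_iff.mp hUV'
    have hemb := slice_isClosedEmbedding hP hx
    have hU : IsSubvariety U :=
      ⟨image_fst_image_slice hP hx U ▸ hU'.1.image _ (mor F p).continuous.continuousOn,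
        hemb.isClosed_iff_image_isClosed.mpr hU'.2⟩
    have hWU : W ⊂ U :=
      ⟨(Set.image_subset_image_iff hemb.injective).mp hWU'.1, fun h => hWU'.2 (Set.image_mono h)⟩
    obtain ⟨h1, h2⟩ := hW.weakDefect_lt hF hx hU hWU hUV
    have h3 := (isSigmaSpecial_weaklySpecialClosure_iff_defect hF hP hx hU.1).mp h1
    have h4 := (isSigmaSpecial_weaklySpecialClosure_iff_defect hF hP hx hW.prop.1.1.1).mp
      hW.prop.1.2.2
    omega
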